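/- **Setting.** For $n\ge 1$ let $V=\mathbb C[x_0,\dots,x_n]_d$ be the space of forms of degree $d$, with the action $(g\cdot f)(x)=f(g^{-1}x)$ of $G=SL(n+1,\mathbb C)$. For a subgroup $H\subseteq G$, a form $f\in V$ is *stable under $H$* if the orbit $H\cdot f$ is closed in $V$ and does not contain $0$, and the stabilizer of $f$ in $H$ is finite. Let $T$ be a maximal torus of $G_{[f]}=\{g\in G : g\cdot f\in\mathbb C f\}$ and let $Z_G(T)$ be the identity component of the centralizer of $T$ in $G$. A *lift* of $Z_G(T)/T$ is an algebraic subgroup $H\subseteq Z_G(T)$ with $Z_G(T)=H\cdot T$ and $H\cap T$ finite (a splitting of $Z_G(T)\to Z_G(T)/T$ up to a finite group). The form $f$ is *relatively stable* if, for some such $T$ and $H$, it is stable under $H$. Let $p_1,\dots,p_s\in\mathbb P^n$ be distinct points and $m_1,\dots,m_s\ge 1$ integers, and let $N$ be the subscheme with ideal $\mathcal I_N=\mathcal I_{p_1}^{m_1}\cap\dots\cap\mathcal I_{p_s}^{m_s}$ (a weighted point configuration). Its form is $f_N=\prod_{j=1}^s l_j^{m_j}$, where $l_j(x)=\sum_i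 p_j^i x_i$; it is defined up to a nonzero scalar. $N$ is *Chow-stable* if $f_N$ is stable under $SL(n+1,\mathbb C)$, and *relatively Chow-stable* if $f_N$ is relatively stable. For points on a line $L\subset\mathbb P^n$, *Chow-stable as a subscheme of $L$* means that, after identifying $L$ with $\mathbb P^1$ by linear coordinates, the configuration of the same points with the same multiplicities in $\mathbb P^1$ is Chow-stable. **Theorem.** Let $p_1,\dots,p_s\in\mathbb P^2$ be distinct points, $m_1,\dots,m_s\ge 1$ integers, and $N\subset\mathbb P^2$ the subscheme with ideal $\mathcal I_{p_1}^{m_1}\cap\dots\cap\mathcal I_{p_s}^{m_s}$. Relative Chow-stability of $N$ does not depend on the choice of $T$ and $H$: for every maximal torus $T$ of $G_{[f_N]}$ and every lift $H$ of $Z_G(T)/T$, $f_N$ is stable under $H$ if and only if $N$ is relatively Chow-stable. Moreover: 1. If $s\le 2$, or $s=3$ and $p_1,p_2,p_3$ are not aligned, then $N$ is relatively Chow-stable. 2. If $s\ge 3$ and all $p_j$ lie on a line $L$, then $N$ is relatively Chow-stable if and only if it is Chow-stable as a subscheme of $L$. 3. If $s\ge 4$, all $p_j$ with $j\ne j_0$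 lie on a line $L$, and $p_{j_0}\notin L$, then $N$ is relatively Chow-stable if and only if the subscheme $N'$ with ideal $\bigcap_{j\ne j_0}\mathcal I_{p_j}^{m_j}$ is Chow-stable as a subscheme of $L$. 4. If $s\ge 4$ and four of the points $p_j$ are three by three non-aligned, then $N$ is relatively Chow-stable if and only if it is Chow-stable. -/

import Mathlib

open scoped LinearAlgebra.Projectivization

/-! ### Stability of a vector under a group action -/

namespace GIT

variable {G V : Type*} [Group G] [TopologicalSpace V] [Zero V] [MulAction G V]

/-- `v` is polystable under the subgroup `H`: its `H`-orbit is closed and does not contain `0`. -/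
def IsPolystable (H : Subgroup G) (v : V) : Prop :=
  IsClosed (MulAction.orbit H v) ∧ (0 : V) ∉ MulAction.orbit H v

/-- `v` is stable under `H`: it is polystable and its stabilizer in `H` is finite. -/
def IsStable (H : Subgroup G) (v : V) : Prop :=
  IsPolystable H v ∧ Finite (MulAction.stabilizer H v)

end GIT

/-! ### Forms of degree `d` in `n` variables as a representation of `SL(n, ℂ)` -/

/-- The space `ℂ[x₁, …, xₙ]_d` of forms of degree `d`. -/
abbrev Form (n d : ℕ) : Type :=
  MvPolynomial.homogeneousSubmodule (Fin n) ℂ d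

namespace Form

variable {n d : ℕ}

/-- The usual topology of the finite dimensional complex vector space of forms,
given by the coefficients. -/
noncomputable instance : TopologicalSpace (Form n d) :=
  TopologicalSpace.induced
    (fun (f : Form n d) (a : Fin n →₀ ℕ) => MvPolynomial.coeff a (f : MvPolynomial (Fin n) ℂ))
    inferInstance

/-- The polynomial `f(A x)`. -/
noncomputable def subst (A : Matrix (Fin n) (Fin n) ℂ) (f : MvPolynomial (Fin n) ℂ) :
    MvPolynomial (Fin n) ℂ :=
  MvPolynomial.aeval (fun i => ∑ j, MvPolynomial.C (A i j) * MvPolynomial.X j) f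

theorem eval_subst (A : Matrix (Fin n) (Fin n) ℂ) (f : MvPolynomial (Fin n) ℂ)
    (x : Fin n → ℂ) :
    MvPolynomial.eval x (subst A f) = MvPolynomial.eval (A.mulVec x) f := by
  unfold subst
  induction f using MvPolynomial.induction_on with
  | C a => rw [MvPolynomial.aeval_C, MvPolynomial.algebraMap_eq, MvPolynomial.eval_C,
      MvPolynomial.eval_C]
  | add p q hp hq => rw [map_add, map_add, map_add, hp, hq]
  | mul_X p i hp =>
    rw [map_mul, map_mul, map_mul, hp, MvPolynomial.aeval_X, MvPolynomial.eval_X]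
    simp [Matrix.mulVec, dotProduct]

theorem subst_isHomogeneous (A : Matrix (Fin n) (Fin n) ℂ) {f : MvPolynomial (Fin n) ℂ}
    (hf : f.IsHomogeneous d) : (subst A f).IsHomogeneous d := by
  have h := hf.aeval (fun i => ∑ j, MvPolynomial.C (A i j) * MvPolynomial.X j) (n := 1)
    (fun i => MvPolynomial.IsHomogeneous.sum _ _ _ fun j _ => by
      simpa using (MvPolynomial.isHomogeneous_C (Fin n) (A i j)).mul
        (MvPolynomial.isHomogeneous_X ℂ j))
  simpa [subst] using h

/-- The action `(g • f)(x) = f(g⁻¹ x)` of `SL(n, ℂ)` on forms. -/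
noncomputable instance : MulAction (Matrix.SpecialLinearGroup (Fin n) ℂ) (Form n d) where
  smul g f := ⟨subst (g⁻¹ : Matrix.SpecialLinearGroup (Fin n) ℂ).1 f.1,
    subst_isHomogeneous _ f.2⟩
  one_smul f := by
    apply Subtype.ext
    apply MvPolynomial.funext
    intro x
    change MvPolynomial.eval x (subst _ f.1) = _
    rw [eval_subst]
    simp
  mul_smul g h f := by
    apply Subtype.ext
    apply MvPolynomial.funext
    intro x
    change MvPolynomial.eval x (subst _ f.1) = MvPolynomial.eval x (subst _ (subst _ f.1))
    rw [eval_subst, eval_subst, eval_subst, Matrix.mulVec_mulVec, mul_inv_rev]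
    rfl

theorem eval_smul (g : Matrix.SpecialLinearGroup (Fin n) ℂ) (f : Form n d) (x : Fin n → ℂ) :
    MvPolynomial.eval x ((g • f : Form n d) : MvPolynomial (Fin n) ℂ) =
      MvPolynomial.eval ((g⁻¹ : Matrix.SpecialLinearGroup (Fin n) ℂ).1.mulVec x) f.1 :=
  eval_subst _ _ _

end Form

/-! ### Tori and algebraic subgroups of `SL(n, ℂ)` -/

/-- `T` is an algebraic torus: the image of an injective homomorphism `(ℂˣ)^r → SL(n, ℂ)` whose
matrix entries are Laurent polynomials. -/
def IsAlgebraicTorus {n : ℕ} (T : Subgroup (Matrix.SpecialLinearGroup (Fin n) ℂ)) : Prop :=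
  ∃ (r : ℕ) (φ : (Fin r → ℂˣ) →* Matrix.SpecialLinearGroup (Fin n) ℂ),
    Function.Injective φ ∧
    (∀ i j, ∃ q : MvPolynomial (Fin r ⊕ Fin r) ℂ, ∀ t : Fin r → ℂˣ,
      (φ t).1 i j =
        MvPolynomial.eval (Sum.elim (fun k => (t k : ℂ)) (fun k => ((t k)⁻¹ : ℂ))) q) ∧
    φ.range = T

/-- `H` is a Zariski closed subgroup: it is the zero locus of polynomials in the matrix entries. -/
def IsAlgebraicSubgroup {n : ℕ} (H : Subgroup (Matrix.SpecialLinearGroup (Fin n) ℂ)) : Prop :=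
  ∃ S : Set (MvPolynomial (Fin n × Fin n) ℂ),
    ∀ g : Matrix.SpecialLinearGroup (Fin n) ℂ,
      g ∈ H ↔ ∀ q ∈ S, MvPolynomial.eval (fun ij => g.1 ij.1 ij.2) q = 0

/-- The identity component of the centralizer of `T`. -/
noncomputable def connectedCentralizer {n : ℕ}
    (T : Subgroup (Matrix.SpecialLinearGroup (Fin n) ℂ)) :
    Subgroup (Matrix.SpecialLinearGroup (Fin n) ℂ) :=
  (Subgroup.connectedComponentOfOne
    (Subgroup.centralizer (T : Set (Matrix.SpecialLinearGroup (Fin n) ℂ)))).map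
      (Subgroup.subtype _)

/-! ### Relative stability -/

section Relative

variable {n d : ℕ}

/-- The stabilizer of the line `[f]`, as a set. -/
def lineStabilizer (f : Form n d) : Set (Matrix.SpecialLinearGroup (Fin n) ℂ) :=
  {g | g • f ∈ Submodule.span ℂ {f}}

/-- `T` is a maximal torus of the stabilizer of `[f]`. -/
def IsMaximalTorusOfStabilizer (f : Form n d)
    (T : Subgroup (Matrix.SpecialLinearGroup (Fin n) ℂ)) : Prop :=
  Maximal (fun T' : Subgroup (Matrix.SpecialLinearGroup (Fin n) ℂ) =>
    IsAlgebraicTorus T' ∧ (T' : Set (Matrix.SpecialLinearGroup (Fin n) ℂ)) ⊆ lineStabilizer f) T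

/-- `H` is a lift of the quotient `Z(T)/T` to the identity component `Z(T)` of the centralizer of
the torus `T`, up to a finite group: an algebraic subgroup of `Z(T)` that maps onto `Z(T)/T` with
finite kernel. -/
structure IsQuotientLift (T H : Subgroup (Matrix.SpecialLinearGroup (Fin n) ℂ)) : Prop where
  algebraic : IsAlgebraicSubgroup H
  le_centralizer : H ≤ connectedCentralizer T
  surjective : ∀ z ∈ connectedCentralizer T, ∃ h ∈ H, ∃ t ∈ T, z = h * t
  finite_kernel : Finite (H ⊓ T : Subgroup (Matrix.SpecialLinearGroup (Fin n) ℂ))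

/-- `f` is relatively stable: it is stable under (a lift `H` to `SL(n, ℂ)` of) the group `Z(T)/T`,
where `T` is a maximal torus of the stabilizer of `[f]`. -/
def IsRelativelyStable (f : Form n d) : Prop :=
  ∃ T H : Subgroup (Matrix.SpecialLinearGroup (Fin n) ℂ),
    IsMaximalTorusOfStabilizer f T ∧ IsQuotientLift T H ∧ GIT.IsStable H f

end Relative

/-! ### Weighted configurations of points -/

section Configuration

variable {n : ℕ} {ι : Type*} [Fintype ι]

/-- The form `∏ⱼ lⱼ^{mⱼ}` of the weighted configuration `(pⱼ, mⱼ)`, where `lⱼ = ∑ᵢ pⱼⁱ xᵢ` is the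
Chow form of `pⱼ`. It is defined up to a nonzero scalar; we use the chosen representative vectors
of the points. -/
noncomputable def chowForm (p : ι → ℙ ℂ (Fin n → ℂ)) (m : ι → ℕ) : Form n (∑ j, m j) :=
  ⟨∏ j, (∑ i, MvPolynomial.C ((p j).rep i) * MvPolynomial.X i) ^ m j, by
    refine MvPolynomial.IsHomogeneous.prod _ _ _ fun j _ => ?_
    have h : (∑ i, MvPolynomial.C ((p j).rep i) * MvPolynomial.X i :
        MvPolynomial (Fin n) ℂ).IsHomogeneous 1 :=
      MvPolynomial.IsHomogeneous.sum _ _ _ fun i _ => by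
        simpa using (MvPolynomial.isHomogeneous_C (Fin n) ((p j).rep i)).mul
          (MvPolynomial.isHomogeneous_X ℂ i)
    simpa using h.pow (m j)⟩

/-- Chow stability of the weighted configuration in `ℙⁿ⁻¹`: stability of its form under the whole
group `SL(n, ℂ)`. -/
def IsChowStable (p : ι → ℙ ℂ (Fin n → ℂ)) (m : ι → ℕ) : Prop :=
  GIT.IsStable (⊤ : Subgroup (Matrix.SpecialLinearGroup (Fin n) ℂ)) (chowForm p m)

/-- Relative Chow stability of the weighted configuration in `ℙⁿ⁻¹`. -/
def IsRelativelyChowStable (p : ι → ℙ ℂ (Fin n → ℂ)) (m : ι → ℕ) : Prop :=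
  IsRelativelyStable (chowForm p m)

/-- Chow stability inside the line `ℙ(L)`, for points lying on it: identify `ℙ¹` with `ℙ(L)` by a
linear isomorphism `ℂ² ≃ L`; the points `qⱼ ∈ ℙ¹` corresponding to the `pⱼ`, with
weights `mⱼ`, form a Chow stable configuration. -/
def IsChowStableOnLine (L : Submodule ℂ (Fin n → ℂ)) (p : ι → ℙ ℂ (Fin n → ℂ)) (m : ι → ℕ) :
    Prop :=
  ∃ (e : (Fin 2 → ℂ) ≃ₗ[ℂ] L) (q : ι → ℙ ℂ (Fin 2 → ℂ)),
    (∀ j, Projectivization.map (L.subtype.comp e.toLinearMap)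
      (L.injective_subtype.comp e.injective) (q j) = p j) ∧
    IsChowStable q m

end Configuration

/-!
The Chow form of a configuration is a product of powers of linear forms, so an element of the
stabilizer of its line permutes the points. A torus is divisible and therefore fixes every point
(`IsAlgebraicTorus.subset_lineStabilizer_chowForm_iff`): the tori in question are those for which
the vectors of the points are simultaneous eigenvectors. Tori are moreover diagonalizable
(`IsAlgebraicTorus.span_rowEigenvectors`), because the elements of finite order are semisimple,
commute, and are Zariski dense. Distinct points of the plane are in one of three positions
(`position_trichotomy`), and each position determines the maximal tori and the lifts.

* Independent points. A maximal torus is the full diagonal torus of a basis that contains the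
  points. It is its own centralizer, so lifts are finite and the form is always stable
  (`isRelativelyStable_of_linearIndependent`).
* Four points in general position. The elements that fix them are homotheties, so the only torus is
  trivial, and since `SL(3, ℂ)` is connected its only lift is `SL(3, ℂ)`
  (`isRelativelyStable_iff_of_four_points`).
* At least three points on a line and at most one off it. A torus acts by homotheties on the plane
  over the line, so a maximal one is conjugate to the torus of all `diag(t, t, t⁻²)`, with
  centralizer `S(GL₂ × GL₁)`. The torus is central there and `SL(2, ℂ)` is perfect, so every lift
  contains the block `SL(2, ℂ)`, with finite index. The form is the product of a power of one linear
  form, fixed by the block, and a binary form, which is the Chow form of the points on the line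
  (`isRelativelyStable_iff_of_plane`).

Passing to a subgroup `K` of finite index in `H` preserves stability
(`GIT.isStable_iff_of_finiteIndex`). That a closed `H`-orbit has closed `K`-orbits follows from
the open mapping theorem for transitive actions of σ-compact groups on Baire spaces: the `K`-orbits
in it are open, hence also closed.
-/


/-! ### Closed orbits of subgroups of finite index -/

namespace GIT

open scoped Pointwise

section FiniteIndex

variable {G V : Type*} [Group G] [MulAction G V]

theorem mem_orbit_subgroup {H : Subgroup G} {v w : V} :
    w ∈ MulAction.orbit H v ↔ ∃ h ∈ H, h • v = w :=
  ⟨fun ⟨h, hw⟩ => ⟨h, h.2, hw⟩, fun ⟨h, hh, hw⟩ => ⟨⟨h, hh⟩, hw⟩⟩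

theorem finite_stabilizer_iff_of_finiteIndex {H K : Subgroup G} {v : V} (hKH : K ≤ H)
    [hfi : (K.subgroupOf H).FiniteIndex] :
    Finite (MulAction.stabilizer H v) ↔ Finite (MulAction.stabilizer K v) := by
  let S := MulAction.stabilizer H v
  have e : MulAction.stabilizer K v ≃ (K.subgroupOf H).subgroupOf S :=
    { toFun := fun k => ⟨⟨⟨k.1.1, hKH k.1.2⟩, k.2⟩, k.1.2⟩
      invFun := fun k => ⟨⟨k.1.1.1, k.2⟩, k.1.2⟩
      left_inv := fun _ => rfl
      right_inv := fun _ => rfl }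
  rw [e.finite_iff]
  refine ⟨fun _ => inferInstance, fun _ => Nat.finite_of_card_ne_zero ?_⟩
  rw [← Subgroup.card_mul_index ((K.subgroupOf H).subgroupOf S)]
  exact mul_ne_zero Nat.card_pos.ne' Subgroup.FiniteIndex.index_ne_zero

variable [TopologicalSpace G] [TopologicalSpace V] [ContinuousSMul G V]
  {H K : Subgroup G} {v : V}

/-- If `K` has finite index in `H`, an `H`-orbit is a finite union of translates of `K`-orbits. -/
theorem isClosed_orbit_of_finiteIndex (hKH : K ≤ H) [(K.subgroupOf H).FiniteIndex]
    (hK : IsClosed (MulAction.orbit K v)) : IsClosed (MulAction.orbit H v) := by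
  have h : MulAction.orbit H v =
      ⋃ q : H ⧸ K.subgroupOf H, (q.out : G) • MulAction.orbit K v := by
    ext w
    simp only [Set.mem_iUnion, Set.mem_smul_set, mem_orbit_subgroup]
    constructor
    · rintro ⟨g, hg, rfl⟩
      let g' : H := ⟨g, hg⟩
      have hk := QuotientGroup.eq.mp (QuotientGroup.out_eq' (g' : H ⧸ K.subgroupOf H))
      refine ⟨g', _, ⟨_, hk, rfl⟩, ?_⟩
      simp [g', smul_smul]
    · rintro ⟨q, _, ⟨k, hk, rfl⟩, rfl⟩
      exact ⟨q.out * k, H.mul_mem q.out.2 (hKH hk), mul_smul _ _ _⟩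
  rw [h]
  exact isClosed_iUnion_of_finite fun q => hK.smul _

variable [IsTopologicalGroup G] [T2Space V]

/-- The converse of `isClosed_orbit_of_finiteIndex` rests on the open mapping theorem for
transitive actions: the `K`-orbits in the closed set `H • v` are open in it. -/
theorem isClosed_orbit_of_isClosed_orbit_of_finiteIndex [LocallyCompactSpace V]
    [SigmaCompactSpace H] (hKH : K ≤ H) [(K.subgroupOf H).FiniteIndex]
    (hKc : IsClosed (K : Set G))
    (hH : IsClosed (MulAction.orbit H v)) : IsClosed (MulAction.orbit K v) := by
  have hopen : IsOpen (K.subgroupOf H : Set H) :=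
    Subgroup.isOpen_of_isClosed_of_finiteIndex _ (hKc.preimage continuous_subtype_val)
  have : LocallyCompactSpace (MulAction.orbit H v) :=
    hH.isClosedEmbedding_subtypeVal.locallyCompactSpace
  have hcont : ContinuousSMul H (MulAction.orbit H v) :=
    ⟨Continuous.subtype_mk (by
      change Continuous fun p : H × MulAction.orbit H v => (p.1 : G) • (p.2 : V)
      fun_prop) _⟩
  have hmap : ∀ x : MulAction.orbit H v, IsOpen ((fun g : H => g • x) '' (K.subgroupOf H)) :=
    fun x => isOpenMap_smul_of_sigmaCompact x _ hopen
  have hcl : IsClosed {x : MulAction.orbit H v | (x : V) ∈ MulAction.orbit K v} := by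
    rw [← isOpen_compl_iff]
    refine isOpen_iff_forall_mem_open.mpr fun x hx => ⟨_, ?_, hmap x, ⟨1, K.one_mem, one_smul _ _⟩⟩
    rintro _ ⟨k, hk, rfl⟩ ⟨k', hk'⟩
    refine hx ⟨⟨k, hk⟩⁻¹ * k', ?_⟩
    change ((k : G)⁻¹ * (k' : G)) • v = x
    have hk' : (k' : G) • v = (k : G) • (x : V) := hk'
    rw [mul_smul, hk', inv_smul_smul]
  have himage : MulAction.orbit K v =
      Subtype.val '' {x : MulAction.orbit H v | (x : V) ∈ MulAction.orbit K v} := by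
    ext w
    constructor
    · rintro ⟨k, rfl⟩
      exact ⟨⟨_, ⟨⟨k, hKH k.2⟩, rfl⟩⟩, ⟨k, rfl⟩, rfl⟩
    · rintro ⟨x, hx, rfl⟩
      exact hx
  rw [himage]
  exact hH.isClosedEmbedding_subtypeVal.isClosedMap _ hcl

theorem isStable_iff_of_finiteIndex [Zero V] [LocallyCompactSpace V]
    [SigmaCompactSpace H] (hKH : K ≤ H) [(K.subgroupOf H).FiniteIndex]
    (hKc : IsClosed (K : Set G)) (hzero : ∀ g : G, g • (0 : V) = 0) :
    IsStable H v ↔ IsStable K v := by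
  have h0 : ∀ L : Subgroup G, (0 : V) ∈ MulAction.orbit L v ↔ v = 0 := by
    intro L
    rw [mem_orbit_subgroup]
    refine ⟨fun ⟨g, _, hg⟩ => ?_, fun h => ⟨1, L.one_mem, by rw [h, hzero]⟩⟩
    rw [← inv_smul_smul g v, hg, hzero]
  unfold IsStable IsPolystable
  rw [h0, h0, finite_stabilizer_iff_of_finiteIndex hKH]
  refine and_congr_left fun _ => and_congr_left fun _ => ⟨?_, ?_⟩
  · exact isClosed_orbit_of_isClosed_orbit_of_finiteIndex hKH hKc
  · exact isClosed_orbit_of_finiteIndex hKH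

end FiniteIndex

end GIT

/-! ### The topological vector space of forms -/

namespace Form

variable {n d : ℕ}

/-- The coefficients of a form, as a linear map; it induces the topology. -/
noncomputable def coeffs : Form n d →ₗ[ℂ] ((Fin n →₀ ℕ) → ℂ) where
  toFun f a := MvPolynomial.coeff a f.1
  map_add' f g := by ext a; simp
  map_smul' c f := by ext a; simp

theorem coeffs_injective : Function.Injective (coeffs : Form n d →ₗ[ℂ] _) := fun _ _ h =>
  Subtype.ext (MvPolynomial.ext _ _ fun a => congrFun h a)

theorem continuous_coeffs : Continuous (coeffs : Form n d →ₗ[ℂ] _) := continuous_induced_dom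

instance : IsTopologicalAddGroup (Form n d) :=
  topologicalAddGroup_induced (coeffs : Form n d →ₗ[ℂ] _)

instance : ContinuousSMul ℂ (Form n d) :=
  continuousSMul_induced (coeffs : Form n d →ₗ[ℂ] _)

instance : T2Space (Form n d) :=
  T2Space.of_injective_continuous coeffs_injective continuous_coeffs

instance : FiniteDimensional ℂ (Form n d) :=
  Module.Finite.iff_fg.mpr (MvPolynomial.homogeneousSubmodule_fg (Fin n) ℂ d)

instance : LocallyCompactSpace (Form n d) :=
  (ContinuousLinearEquiv.ofFinrankEq (𝕜 := ℂ) (E := Form n d)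
    (F := Fin (Module.finrank ℂ (Form n d)) → ℂ)
    (by simp)).toHomeomorph.isClosedEmbedding.locallyCompactSpace

theorem ext_eval {f g : Form n d}
    (h : ∀ x : Fin n → ℂ, MvPolynomial.eval x f.1 = MvPolynomial.eval x g.1) : f = g :=
  Subtype.ext (MvPolynomial.funext h)

/-- The values of a form, as a linear map. -/
noncomputable def evals : Form n d →ₗ[ℂ] ((Fin n → ℂ) → ℂ) where
  toFun f x := MvPolynomial.eval x f.1
  map_add' f g := by ext x; simp
  map_smul' c f := by ext x; simp

theorem isClosedEmbedding_evals :
    Topology.IsClosedEmbedding (evals : Form n d →ₗ[ℂ] ((Fin n → ℂ) → ℂ)) :=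
  LinearMap.isClosedEmbedding_of_injective
    (LinearMap.ker_eq_bot.mpr fun _ _ h => ext_eval fun x => congrFun h x)

/-- The linear map by which an element of `SL(n, ℂ)` acts on forms. -/
noncomputable def smulLinear (g : Matrix.SpecialLinearGroup (Fin n) ℂ) :
    Form n d →ₗ[ℂ] Form n d where
  toFun f := g • f
  map_add' f f' := ext_eval fun x => by
    simp only [eval_smul, Submodule.coe_add, map_add]
  map_smul' c f := ext_eval fun x => by
    simp only [eval_smul, Submodule.coe_smul, MvPolynomial.smul_eval, RingHom.id_apply]

theorem smul_zero' (g : Matrix.SpecialLinearGroup (Fin n) ℂ) : g • (0 : Form n d) = 0 :=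
  (smulLinear g).map_zero

theorem continuous_smul_form (f : Form n d) :
    Continuous fun g : Matrix.SpecialLinearGroup (Fin n) ℂ => g • f := by
  rw [isClosedEmbedding_evals.isInducing.continuous_iff]
  refine continuous_pi fun x => ?_
  change Continuous fun g : Matrix.SpecialLinearGroup (Fin n) ℂ => MvPolynomial.eval x (g • f).1
  simp only [eval_smul]
  refine (MvPolynomial.continuous_eval _).comp ?_
  have hinv : Continuous fun g : Matrix.SpecialLinearGroup (Fin n) ℂ =>
      (g⁻¹ : Matrix.SpecialLinearGroup (Fin n) ℂ).1 :=
    Matrix.SpecialLinearGroup.isClosedEmbedding_val.continuous.comp continuous_inv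
  exact hinv.matrix_mulVec continuous_const

theorem smul_eq_sum (b : Module.Basis (Fin (Module.finrank ℂ (Form n d))) ℂ (Form n d))
    (g : Matrix.SpecialLinearGroup (Fin n) ℂ) (f : Form n d) :
    g • f = ∑ i, b.coord i f • (g • b i) := by
  change smulLinear g f = ∑ i, b.coord i f • smulLinear g (b i)
  conv_lhs => rw [← b.sum_repr f]
  rw [map_sum]
  exact Finset.sum_congr rfl fun i _ => map_smul _ _ _

instance : ContinuousSMul (Matrix.SpecialLinearGroup (Fin n) ℂ) (Form n d) := by
  constructor
  let b := Module.finBasis ℂ (Form n d)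
  have h : (fun p : Matrix.SpecialLinearGroup (Fin n) ℂ × Form n d => p.1 • p.2) =
      fun p => ∑ i, b.coord i p.2 • (p.1 • b i) := funext fun p => smul_eq_sum b p.1 p.2
  rw [h]
  have hb : ∀ i, Continuous (b.coord i) := fun i => (b.coord i).continuous_of_finiteDimensional
  have hg : ∀ i, Continuous fun g : Matrix.SpecialLinearGroup (Fin n) ℂ => g • b i :=
    fun i => continuous_smul_form (b i)
  exact continuous_finsetSum _ fun i _ =>
    ((hb i).comp continuous_snd).smul ((hg i).comp continuous_fst)

end Form

/-! ### Row eigenvectors of tori -/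

section RowEigenvectors

variable {n : ℕ}

/-- The elements `g` of `SL(n, ℂ)` for which the row vector `v` is an eigenvector, `v g = c v`.
Rows appear because `g` sends the linear form `x ↦ v · x` to `x ↦ (v g⁻¹) · x`. -/
def rowStabilizer (v : Fin n → ℂ) : Subgroup (Matrix.SpecialLinearGroup (Fin n) ℂ) where
  carrier := {g | ∃ c : ℂˣ, Matrix.vecMul v g.1 = c • v}
  one_mem' := ⟨1, by simp⟩
  mul_mem' := by
    rintro g h ⟨c, hc⟩ ⟨c', hc'⟩
    refine ⟨c * c', ?_⟩
    rw [Matrix.SpecialLinearGroup.coe_mul, ← Matrix.vecMul_vecMul, hc, Matrix.smul_vecMul, hc',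
      smul_smul]
  inv_mem' := by
    rintro g ⟨c, hc⟩
    refine ⟨c⁻¹, ?_⟩
    have h : Matrix.vecMul (Matrix.vecMul v g.1) (g⁻¹).1 = v := by
      rw [Matrix.vecMul_vecMul, ← Matrix.SpecialLinearGroup.coe_mul, mul_inv_cancel]
      simp
    rw [hc, Matrix.smul_vecMul] at h
    rw [eq_inv_smul_iff, h]

theorem mem_rowStabilizer {v : Fin n → ℂ} {g : Matrix.SpecialLinearGroup (Fin n) ℂ} :
    g ∈ rowStabilizer v ↔ ∃ c : ℂˣ, Matrix.vecMul v g.1 = c • v := Iff.rfl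

theorem vecMul_ne_zero {v : Fin n → ℂ} (hv : v ≠ 0) (g : Matrix.SpecialLinearGroup (Fin n) ℂ) :
    Matrix.vecMul v g.1 ≠ 0 := by
  intro h
  apply hv
  have h' : Matrix.vecMul (Matrix.vecMul v g.1) (g⁻¹).1 = v := by
    rw [Matrix.vecMul_vecMul, ← Matrix.SpecialLinearGroup.coe_mul, mul_inv_cancel]
    simp
  rw [← h', h, Matrix.zero_vecMul]

theorem mem_rowStabilizer_of_eq_smul {v : Fin n → ℂ} {g : Matrix.SpecialLinearGroup (Fin n) ℂ}
    {c : ℂ} (h : Matrix.vecMul v g.1 = c • v) : g ∈ rowStabilizer v := by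
  rcases eq_or_ne v 0 with rfl | hv
  · exact ⟨1, by simp⟩
  · have hc : c ≠ 0 := by
      rintro rfl
      exact vecMul_ne_zero hv g (by simpa using h)
    exact ⟨Units.mk0 c hc, h⟩

theorem exists_eq_smul_of_mul_eq_mul {v w : Fin n → ℂ} (hv : v ≠ 0)
    (h : ∀ i j, w i * v j - w j * v i = 0) : ∃ c : ℂ, w = c • v := by
  obtain ⟨j, hj⟩ := Function.ne_iff.mp hv
  have hj : v j ≠ 0 := hj
  refine ⟨w j / v j, funext fun i => ?_⟩
  have := h i j
  simp only [Pi.smul_apply, smul_eq_mul]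
  field_simp
  linear_combination this

end RowEigenvectors

section Laurent

/-- A Laurent polynomial function of `z ∈ ℂˣ` becomes polynomial after multiplication by a power
of `z`. -/
theorem exists_pow_mul_eval_eq_polynomial {r : ℕ} (k : Fin r)
    (Q : MvPolynomial (Fin r ⊕ Fin r) ℂ) :
    ∃ (N : ℕ) (P : Polynomial ℂ), ∀ z : ℂˣ,
      (z : ℂ) ^ N * MvPolynomial.eval (Sum.elim
        (fun i => ((Pi.mulSingle k z : Fin r → ℂˣ) i : ℂ))
        (fun i => (((Pi.mulSingle k z : Fin r → ℂˣ) i)⁻¹ : ℂ))) Q = P.eval (z : ℂ) := by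
  induction Q using MvPolynomial.induction_on with
  | C a => exact ⟨0, Polynomial.C a, fun z => by simp⟩
  | add p q hp hq =>
    obtain ⟨N, P, hP⟩ := hp
    obtain ⟨M, R, hR⟩ := hq
    refine ⟨N + M, Polynomial.X ^ M * P + Polynomial.X ^ N * R, fun z => ?_⟩
    rw [map_add, Polynomial.eval_add, Polynomial.eval_mul, Polynomial.eval_mul, ← hP, ← hR]
    simp only [Polynomial.eval_pow, Polynomial.eval_X]
    ring
  | mul_X p i hp =>
    obtain ⟨N, P, hP⟩ := hp
    rcases i with i | i
    · by_cases hi : i = k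
      · subst hi
        refine ⟨N, P * Polynomial.X, fun z => ?_⟩
        rw [map_mul, Polynomial.eval_mul, ← hP]
        simp [mul_assoc]
      · refine ⟨N, P, fun z => ?_⟩
        rw [map_mul, ← hP]
        simp [Pi.mulSingle_eq_of_ne hi]
    · by_cases hi : i = k
      · subst hi
        refine ⟨N + 1, P, fun z => ?_⟩
        rw [map_mul, ← hP]
        simp [pow_succ]
        field_simp
      · refine ⟨N, P, fun z => ?_⟩
        rw [map_mul, ← hP]
        simp [Pi.mulSingle_eq_of_ne hi]

theorem infinite_isOfFinOrder_units : {z : ℂˣ | IsOfFinOrder z}.Infinite := by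
  have hroot : ∀ k : ℕ, ∃ z : ℂˣ, orderOf z = k + 1 := fun k => by
    have h := Complex.isPrimitiveRoot_exp (k + 1) k.succ_ne_zero
    obtain ⟨u, hu⟩ := h.isUnit k.succ_ne_zero
    refine ⟨u, ?_⟩
    rw [← orderOf_units, hu, ← h.eq_orderOf]
  choose z hz using hroot
  refine Set.infinite_of_injective_forall_mem (f := z) (fun a b hab => ?_) fun k => ?_
  · have := hz a
    rw [hab, hz b] at this
    omega
  · exact orderOf_pos_iff.mp (by rw [hz]; omega)

/-- Roots of unity are Zariski dense in `ℂˣ`. -/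
theorem eval_mulSingle_eq_zero_of_isOfFinOrder {r : ℕ} (k : Fin r)
    (Q : MvPolynomial (Fin r ⊕ Fin r) ℂ)
    (hQ : ∀ z : ℂˣ, IsOfFinOrder z → MvPolynomial.eval (Sum.elim
        (fun i => ((Pi.mulSingle k z : Fin r → ℂˣ) i : ℂ))
        (fun i => (((Pi.mulSingle k z : Fin r → ℂˣ) i)⁻¹ : ℂ))) Q = 0) (z : ℂˣ) :
    MvPolynomial.eval (Sum.elim
        (fun i => ((Pi.mulSingle k z : Fin r → ℂˣ) i : ℂ))
        (fun i => (((Pi.mulSingle k z : Fin r → ℂˣ) i)⁻¹ : ℂ))) Q = 0 := by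
  obtain ⟨N, P, hP⟩ := exists_pow_mul_eval_eq_polynomial k Q
  have hP0 : P = 0 := by
    refine Polynomial.eq_zero_of_infinite_isRoot P
      ((infinite_isOfFinOrder_units.image Units.val_injective.injOn).mono ?_)
    rintro _ ⟨w, hw, rfl⟩
    change P.eval (w : ℂ) = 0
    rw [← hP, hQ w hw, mul_zero]
  have h := hP z
  rw [hP0, Polynomial.eval_zero] at h
  exact (mul_eq_zero.mp h).resolve_left (pow_ne_zero _ z.ne_zero)

end Laurent

namespace IsAlgebraicTorus

variable {n : ℕ} {T : Subgroup (Matrix.SpecialLinearGroup (Fin n) ℂ)}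

theorem mul_comm (hT : IsAlgebraicTorus T) {g h : Matrix.SpecialLinearGroup (Fin n) ℂ}
    (hg : g ∈ T) (hh : h ∈ T) : g * h = h * g := by
  obtain ⟨r, φ, -, -, rfl⟩ := hT
  obtain ⟨s, rfl⟩ := hg
  obtain ⟨t, rfl⟩ := hh
  rw [← map_mul, ← map_mul, _root_.mul_comm]

/-- Tori are divisible; this plays the role of their connectedness. -/
theorem exists_pow_eq (hT : IsAlgebraicTorus T) {g : Matrix.SpecialLinearGroup (Fin n) ℂ}
    (hg : g ∈ T) {k : ℕ} (hk : k ≠ 0) : ∃ h ∈ T, h ^ k = g := by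
  obtain ⟨r, φ, -, -, rfl⟩ := hT
  obtain ⟨t, rfl⟩ := hg
  have hroot : ∀ i, ∃ z : ℂˣ, z ^ k = t i := fun i => by
    obtain ⟨z, hz⟩ := IsAlgClosed.exists_pow_nat_eq (t i : ℂ) (Nat.pos_of_ne_zero hk)
    have hz0 : z ≠ 0 := by
      rintro rfl
      rw [zero_pow hk] at hz
      exact (t i).ne_zero hz.symm
    exact ⟨Units.mk0 z hz0, Units.ext (by simpa using hz)⟩
  choose z hz using hroot
  exact ⟨φ z, ⟨z, rfl⟩, by rw [← map_pow]; exact congrArg φ (funext hz)⟩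

/-- A row vector that is an eigenvector for the elements of finite order of a torus is an
eigenvector for the whole torus. -/
theorem mem_rowStabilizer_of_isOfFinOrder {r : ℕ}
    (φ : (Fin r → ℂˣ) →* Matrix.SpecialLinearGroup (Fin n) ℂ)
    (hφ : ∀ i j, ∃ q : MvPolynomial (Fin r ⊕ Fin r) ℂ, ∀ t : Fin r → ℂˣ,
      (φ t).1 i j =
        MvPolynomial.eval (Sum.elim (fun k => (t k : ℂ)) (fun k => ((t k)⁻¹ : ℂ))) q)
    {v : Fin n → ℂ} (hv : ∀ t, IsOfFinOrder t → φ t ∈ rowStabilizer v) (t : Fin r → ℂˣ) :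
    φ t ∈ rowStabilizer v := by
  rcases eq_or_ne v 0 with rfl | hv0
  · exact ⟨1, by simp⟩
  choose q hq using hφ
  have hsingle : ∀ (k : Fin r) (z : ℂˣ), φ (Pi.mulSingle k z) ∈ rowStabilizer v := by
    intro k z
    let Q : Fin n → Fin n → MvPolynomial (Fin r ⊕ Fin r) ℂ := fun i j =>
      (∑ a, MvPolynomial.C (v a) * q a i) * MvPolynomial.C (v j) -
        (∑ a, MvPolynomial.C (v a) * q a j) * MvPolynomial.C (v i)
    have hQ : ∀ (z : ℂˣ) i j, MvPolynomial.eval (Sum.elim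
        (fun i => ((Pi.mulSingle k z : Fin r → ℂˣ) i : ℂ))
        (fun i => (((Pi.mulSingle k z : Fin r → ℂˣ) i)⁻¹ : ℂ))) (Q i j) =
        Matrix.vecMul v (φ (Pi.mulSingle k z)).1 i * v j -
          Matrix.vecMul v (φ (Pi.mulSingle k z)).1 j * v i := by
      intro z i j
      simp only [Q, map_sub, map_mul, map_sum, MvPolynomial.eval_C, ← hq, Matrix.vecMul, dotProduct]
    obtain ⟨c, hc⟩ := exists_eq_smul_of_mul_eq_mul (w := Matrix.vecMul v (φ (Pi.mulSingle k z)).1)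
      hv0 fun i j => by
        rw [← hQ]
        refine eval_mulSingle_eq_zero_of_isOfFinOrder k _ (fun w hw => ?_) z
        obtain ⟨c, hc⟩ := hv (Pi.mulSingle k w)
          ((MonoidHom.mulSingle (fun _ : Fin r => ℂˣ) k).isOfFinOrder hw)
        rw [hQ, hc]
        simp only [Pi.smul_apply, Units.smul_def, smul_eq_mul]
        ring
    exact mem_rowStabilizer_of_eq_smul hc
  have ht : t ∈ (rowStabilizer v).comap φ := by
    rw [← Finset.univ_prod_mulSingle t]
    exact Subgroup.prod_mem _ fun k _ => hsingle k (t k)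
  exact ht

/-- The representation of a torus on row vectors is diagonalizable: elements of finite order are
semisimple and commute, and they are Zariski dense. -/
theorem span_rowEigenvectors (hT : IsAlgebraicTorus T) :
    Submodule.span ℂ {v : Fin n → ℂ | T ≤ rowStabilizer v} = ⊤ := by
  obtain ⟨r, φ, -, hφ, rfl⟩ := hT
  let f : {t : Fin r → ℂˣ // IsOfFinOrder t} → Module.End ℂ (Fin n → ℂ) :=
    fun t => (φ t.1).1.vecMulLinear
  have hss : ∀ t, (f t).IsSemisimple := by
    intro t
    obtain ⟨k, hk, htk⟩ := isOfFinOrder_iff_pow_eq_one.mp t.2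
    have hsep : (Polynomial.X ^ k - 1 : Polynomial ℂ).Separable :=
      Polynomial.X_pow_sub_one_separable_iff.mpr (by exact_mod_cast hk.ne')
    refine Module.End.isSemisimple_of_squarefree_aeval_eq_zero hsep.squarefree ?_
    have hpow : ∀ (M : Matrix (Fin n) (Fin n) ℂ) (j : ℕ),
        M.vecMulLinear ^ j = (M ^ j).vecMulLinear := by
      intro M j
      induction j with
      | zero => ext; simp
      | succ j ih =>
        rw [pow_succ, ih]
        refine LinearMap.ext fun x => ?_
        change Matrix.vecMul (Matrix.vecMul x M) (M ^ j) = Matrix.vecMul x (M ^ (j + 1))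
        rw [Matrix.vecMul_vecMul, pow_succ']
    have hone : f t ^ k = 1 := by
      rw [hpow, ← Matrix.SpecialLinearGroup.coe_pow, ← map_pow, htk, map_one]
      refine LinearMap.ext fun x => ?_
      change Matrix.vecMul x 1 = x
      simp
    simp [hone]
  have hcomm : Pairwise fun s t => Commute (f s) (f t) := by
    intro s t _
    refine LinearMap.ext fun x => ?_
    change Matrix.vecMul (Matrix.vecMul x (φ t.1).1) (φ s.1).1 =
      Matrix.vecMul (Matrix.vecMul x (φ s.1).1) (φ t.1).1
    rw [Matrix.vecMul_vecMul, Matrix.vecMul_vecMul, ← Matrix.SpecialLinearGroup.coe_mul,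
      ← Matrix.SpecialLinearGroup.coe_mul, ← map_mul, ← map_mul, _root_.mul_comm]
  have htop := Module.End.iSup_iInf_maxGenEigenspace_eq_top_of_iSup_maxGenEigenspace_eq_top_of_commute
    f hcomm fun t => Module.End.iSup_maxGenEigenspace_eq_top (f t)
  rw [eq_top_iff, ← htop]
  refine iSup_le fun χ v hv => Submodule.subset_span ?_
  rintro _ ⟨t, rfl⟩
  refine mem_rowStabilizer_of_isOfFinOrder φ hφ (fun s hs => ?_) t
  have h := (Submodule.mem_iInf _).mp hv ⟨s, hs⟩
  rw [(hss ⟨s, hs⟩).isFinitelySemisimple.maxGenEigenspace_eq_eigenspace,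
    Module.End.mem_eigenspace_iff] at h
  exact mem_rowStabilizer_of_eq_smul h

end IsAlgebraicTorus

/-! ### The stabilizer of the line of a Chow form -/

section ChowForm

/-- The linear form `x ↦ v · x`. -/
noncomputable def linearForm {n : ℕ} (v : Fin n → ℂ) : MvPolynomial (Fin n) ℂ :=
  ∑ i, MvPolynomial.C (v i) * MvPolynomial.X i

theorem eq_of_smul_rep_eq_smul_rep {n : ℕ} {ι : Type*} {p : ι → ℙ ℂ (Fin n → ℂ)}
    (hp : Function.Injective p) {j k : ι} {c c' : ℂˣ}
    (h : c • (p j).rep = c' • (p k).rep) : j = k := by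
  apply hp
  rw [← (p j).mk_rep, ← (p k).mk_rep, Projectivization.mk_eq_mk_iff]
  exact ⟨c⁻¹ * c', by rw [mul_smul, ← h, inv_smul_smul]⟩

variable {n : ℕ} {ι : Type*} [Fintype ι] (p : ι → ℙ ℂ (Fin n → ℂ)) (m : ι → ℕ)

theorem eval_linearForm (v x : Fin n → ℂ) :
    MvPolynomial.eval x (linearForm v) = v ⬝ᵥ x := by
  simp [linearForm, dotProduct]

theorem eval_chowForm (x : Fin n → ℂ) :
    MvPolynomial.eval x (chowForm p m).1 = ∏ j, ((p j).rep ⬝ᵥ x) ^ m j := by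
  change MvPolynomial.eval x (∏ j, linearForm (p j).rep ^ m j) = _
  simp only [map_prod, map_pow, eval_linearForm]

theorem linearForm_ne_zero {v : Fin n → ℂ} (hv : v ≠ 0) : linearForm v ≠ 0 := by
  intro h
  apply hv
  refine dotProduct_eq_zero _ fun x => ?_
  rw [← eval_linearForm, h, map_zero]

theorem chowForm_ne_zero : chowForm p m ≠ 0 := by
  intro h
  have h' : (chowForm p m).1 = 0 := congrArg Subtype.val h
  simp only [chowForm, Finset.prod_eq_zero_iff] at h'
  obtain ⟨j, -, hj⟩ := h'
  exact linearForm_ne_zero (p j).rep_nonzero (eq_zero_of_pow_eq_zero hj)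

theorem eval_smul_chowForm (g : Matrix.SpecialLinearGroup (Fin n) ℂ) (x : Fin n → ℂ) :
    MvPolynomial.eval x (g • chowForm p m).1 =
      ∏ j, (Matrix.vecMul (p j).rep (g⁻¹).1 ⬝ᵥ x) ^ m j := by
  rw [Form.eval_smul, eval_chowForm]
  simp only [Matrix.dotProduct_mulVec]

theorem mem_lineStabilizer_of_forall_mem_rowStabilizer
    {g : Matrix.SpecialLinearGroup (Fin n) ℂ} (hg : ∀ j, g ∈ rowStabilizer (p j).rep) :
    g ∈ lineStabilizer (chowForm p m) := by
  have hg' : ∀ j, ∃ c : ℂˣ, Matrix.vecMul (p j).rep (g⁻¹).1 = c • (p j).rep :=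
    fun j => (rowStabilizer (p j).rep).inv_mem (hg j)
  choose c hc using hg'
  refine Submodule.mem_span_singleton.mpr ⟨∏ j, (c j : ℂ) ^ m j, ?_⟩
  refine Form.ext_eval fun x => ?_
  rw [eval_smul_chowForm, Submodule.coe_smul, MvPolynomial.smul_eval, eval_chowForm,
    ← Finset.prod_mul_distrib]
  refine Finset.prod_congr rfl fun j _ => ?_
  rw [hc, Units.smul_def, smul_dotProduct, smul_eq_mul, mul_pow]

variable {p m}

/-- If `g` stabilizes the line of the Chow form, it permutes the points: the hyperplane dual to
a point is covered by finitely many hyperplanes, so it is one of them. -/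
theorem exists_vecMul_rep_eq_smul {g : Matrix.SpecialLinearGroup (Fin n) ℂ}
    (hm : ∀ j, 0 < m j) (hg : g ∈ lineStabilizer (chowForm p m)) (j : ι) :
    ∃ (k : ι) (c : ℂˣ), Matrix.vecMul (p k).rep g.1 = c • (p j).rep := by
  obtain ⟨a, ha⟩ := Submodule.mem_span_singleton.mp hg
  have ha0 : a ≠ 0 := by
    rintro rfl
    apply chowForm_ne_zero p m
    rw [← inv_smul_smul g (chowForm p m), ← ha, zero_smul, Form.smul_zero']
  let w : Fin n → ℂ := Matrix.vecMul (p j).rep (g⁻¹).1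
  have hw : w ≠ 0 := vecMul_ne_zero (p j).rep_nonzero g⁻¹
  let W : Submodule ℂ (Fin n → ℂ) := LinearMap.ker (dotProductBilin ℂ ℂ w)
  have hcover : ∀ x : W, ∃ k, (p k).rep ⬝ᵥ (x : Fin n → ℂ) = 0 := by
    intro x
    have hx : w ⬝ᵥ (x : Fin n → ℂ) = 0 := LinearMap.mem_ker.mp x.2
    have h := eval_smul_chowForm p m g x
    rw [Finset.prod_eq_zero (Finset.mem_univ j) (by rw [hx, zero_pow (hm j).ne']), ← ha,
      Submodule.coe_smul, MvPolynomial.smul_eval, mul_eq_zero, eval_chowForm,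
      Finset.prod_eq_zero_iff] at h
    obtain ⟨k, -, hk⟩ := h.resolve_left ha0
    exact ⟨k, eq_zero_of_pow_eq_zero hk⟩
  obtain ⟨k, hk⟩ := Subspace.exists_eq_top_of_iUnion_eq_univ
    (p := fun k => (LinearMap.ker (dotProductBilin ℂ ℂ (p k).rep)).comap W.subtype)
    (Set.eq_univ_of_forall fun x => Set.mem_iUnion.mpr (hcover x))
  obtain ⟨c, hc⟩ := exists_eq_smul_of_mul_eq_mul (w := (p k).rep) hw fun i i' => by
    let x : Fin n → ℂ := w i' • Pi.single i 1 - w i • Pi.single i' 1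
    have hx : x ∈ W := by
      change w ⬝ᵥ x = 0
      simp [x, dotProduct_sub, mul_comm]
    have hx' : (p k).rep ⬝ᵥ x = 0 := by
      have : (⟨x, hx⟩ : W) ∈ (LinearMap.ker (dotProductBilin ℂ ℂ (p k).rep)).comap W.subtype := by
        rw [hk]
        trivial
      exact this
    simp only [x, dotProduct_sub, dotProduct_smul, dotProduct_single, mul_one, smul_eq_mul] at hx'
    linear_combination hx'
  have hc0 : c ≠ 0 := by
    rintro rfl
    exact (p k).rep_nonzero (by rw [hc, zero_smul])
  refine ⟨k, Units.mk0 c hc0, ?_⟩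
  rw [hc, Matrix.smul_vecMul, Matrix.vecMul_vecMul, ← Matrix.SpecialLinearGroup.coe_mul,
    inv_mul_cancel]
  simp [Units.smul_def]

/-- A torus in the stabilizer of the line of the Chow form fixes each point, because a divisible
group of permutations of a finite set is trivial. -/
theorem IsAlgebraicTorus.subset_lineStabilizer_chowForm_iff
    {T : Subgroup (Matrix.SpecialLinearGroup (Fin n) ℂ)} (hT : IsAlgebraicTorus T)
    (hp : Function.Injective p) (hm : ∀ j, 0 < m j) :
    (T : Set (Matrix.SpecialLinearGroup (Fin n) ℂ)) ⊆ lineStabilizer (chowForm p m) ↔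
      ∀ j, T ≤ rowStabilizer (p j).rep := by
  classical
  refine ⟨fun h j g hg => ?_, fun h g hg =>
    mem_lineStabilizer_of_forall_mem_rowStabilizer p m fun j => h j hg⟩
  obtain ⟨g, hgT, rfl⟩ := hT.exists_pow_eq hg (k := Fintype.card (Equiv.Perm ι)) Fintype.card_ne_zero
  choose σ c hσ using exists_vecMul_rep_eq_smul hm (h hgT)
  have hinj : Function.Injective σ := fun j k hjk => by
    have h1 := hσ j
    rw [hjk, hσ k] at h1
    exact (eq_of_smul_rep_eq_smul_rep hp h1).symm
  let e : Equiv.Perm ι := Equiv.ofBijective σ (Finite.injective_iff_bijective.mp hinj)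
  have hiter : ∀ (k : ℕ) (j : ι), ∃ c : ℂˣ,
      Matrix.vecMul (p ((e ^ k) j)).rep (g ^ k).1 = c • (p j).rep := by
    intro k
    induction k with
    | zero => exact fun j => ⟨1, by simp⟩
    | succ k ih =>
      intro j
      obtain ⟨c', hc'⟩ := ih j
      refine ⟨c ((e ^ k) j) * c', ?_⟩
      have h1 : Matrix.vecMul (p ((e ^ (k + 1)) j)).rep g.1 =
          c ((e ^ k) j) • (p ((e ^ k) j)).rep := by
        rw [pow_succ' e k]
        exact hσ _
      rw [pow_succ' g k, Matrix.SpecialLinearGroup.coe_mul, ← Matrix.vecMul_vecMul, h1,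
        Matrix.smul_vecMul, hc', smul_smul]
  obtain ⟨c', hc'⟩ := hiter (Fintype.card (Equiv.Perm ι)) j
  rw [pow_card_eq_one] at hc'
  exact ⟨c', hc'⟩

end ChowForm

/-! ### Connectedness of the special linear group -/

section Connected

theorem mem_connectedComponentOfOne_of_continuous {G : Type*} [Group G] [TopologicalSpace G]
    [IsTopologicalGroup G] {γ : ℂ → G} (hγ : Continuous γ) (h0 : γ 0 = 1) (z : ℂ) :
    γ z ∈ Subgroup.connectedComponentOfOne G :=
  (isPreconnected_range hγ).subset_connectedComponent ⟨0, h0⟩ ⟨z, rfl⟩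

theorem continuous_specialLinearGroup_mk {n : ℕ} {X : Type*} [TopologicalSpace X]
    {γ : X → Matrix.SpecialLinearGroup (Fin n) ℂ} (h : ∀ i j, Continuous fun x => (γ x).1 i j) :
    Continuous γ :=
  Matrix.SpecialLinearGroup.isClosedEmbedding_val.isInducing.continuous_iff.mpr
    (continuous_matrix h)

instance preconnectedSpace_specialLinearGroup {n : ℕ} [Nontrivial (Fin n)] :
    PreconnectedSpace (Matrix.SpecialLinearGroup (Fin n) ℂ) := by
  suffices h : ∀ M : Matrix.SpecialLinearGroup (Fin n) ℂ,
      M ∈ Subgroup.connectedComponentOfOne (Matrix.SpecialLinearGroup (Fin n) ℂ) by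
    refine ⟨?_⟩
    have : (Set.univ : Set (Matrix.SpecialLinearGroup (Fin n) ℂ)) = connectedComponent 1 :=
      (Set.eq_univ_of_forall h).symm
    rw [this]
    exact isPreconnected_connectedComponent
  intro M
  refine Matrix.SpecialLinearGroup.diagonal_transvection_induction'
    (· ∈ Subgroup.connectedComponentOfOne _) M (fun i j hij c hc => ?_) (fun i j hij a => ?_)
    fun _ _ => mul_mem
  · have h := mem_connectedComponentOfOne_of_continuous
      (γ := fun z => Matrix.SpecialLinearGroup.diag2n hij (Complex.exp z) (Complex.exp_ne_zero z))
      (continuous_specialLinearGroup_mk fun k l => ?_) ?_ (Complex.log c)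
    · simpa only [Complex.exp_log hc] using h
    · simp only [Matrix.SpecialLinearGroup.diag2n_coe, Matrix.diagonal_apply]
      split_ifs
      · exact Complex.continuous_exp
      · simp only [← Complex.exp_neg]
        fun_prop
      · fun_prop
      · fun_prop
    · ext k l
      simp [Matrix.SpecialLinearGroup.diag2n_coe]
  · refine mem_connectedComponentOfOne_of_continuous
      (γ := fun z => Matrix.SpecialLinearGroup.transvection hij z)
      (continuous_specialLinearGroup_mk fun k l => ?_) (by simp) a
    simp only [Matrix.SpecialLinearGroup.transvection_coe, Matrix.add_apply, Matrix.single_apply]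
    split_ifs <;> fun_prop

variable {n : ℕ} {T H : Subgroup (Matrix.SpecialLinearGroup (Fin n) ℂ)}

theorem connectedCentralizer_le_centralizer :
    connectedCentralizer T ≤ Subgroup.centralizer (T : Set _) := by
  rintro _ ⟨g, -, rfl⟩
  exact g.2

theorem range_le_connectedCentralizer {G : Type*} [Group G] [TopologicalSpace G]
    [PreconnectedSpace G] {j : G →* Matrix.SpecialLinearGroup (Fin n) ℂ} (hj : Continuous j)
    (h : j.range ≤ Subgroup.centralizer (T : Set _)) : j.range ≤ connectedCentralizer T := by
  rintro _ ⟨g, rfl⟩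
  let j' : G → Subgroup.centralizer (T : Set (Matrix.SpecialLinearGroup (Fin n) ℂ)) :=
    fun g => ⟨j g, h ⟨g, rfl⟩⟩
  have hj' : Continuous j' := hj.subtype_mk _
  refine ⟨j' g, ?_, rfl⟩
  exact (isPreconnected_range hj').subset_connectedComponent
    ⟨1, Subtype.ext (map_one j)⟩ ⟨g, rfl⟩

open scoped commutatorElement in
/-- `T` is central in `Z(T)`, so commutators in `Z(T)` only see the images in `Z(T)/T`, which a lift
reaches. -/
theorem IsQuotientLift.commutator_connectedCentralizer_le (h : IsQuotientLift T H) :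
    ⁅connectedCentralizer T, connectedCentralizer T⁆ ≤ H := by
  rw [Subgroup.commutator_le]
  intro z₁ hz₁ z₂ hz₂
  obtain ⟨h₁, hh₁, t₁, ht₁, rfl⟩ := h.surjective z₁ hz₁
  obtain ⟨h₂, hh₂, t₂, ht₂, rfl⟩ := h.surjective z₂ hz₂
  have hcent : ∀ z ∈ connectedCentralizer T, ∀ t ∈ T, t * z = z * t := fun z hz t ht =>
    Subgroup.mem_centralizer_iff.mp (connectedCentralizer_le_centralizer hz) t ht
  have e21 : Commute t₂ h₁ := hcent _ (h.le_centralizer hh₁) _ ht₂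
  have f12 : Commute t₁ (h₂ * t₂) := hcent _ hz₂ _ ht₁
  have key : ⁅h₁ * t₁, h₂ * t₂⁆ = ⁅h₁, h₂⁆ := by
    have g12 : h₁ * t₁ * (h₂ * t₂) = h₁ * h₂ * (t₂ * t₁) := by
      rw [mul_assoc, f12.eq]; simp only [mul_assoc]
    have g21 : h₂ * t₂ * (h₁ * t₁) = h₂ * h₁ * (t₂ * t₁) := by
      rw [mul_assoc h₂, ← mul_assoc t₂, e21.eq]; simp only [mul_assoc]
    have hc : ∀ a b : Matrix.SpecialLinearGroup (Fin n) ℂ, ⁅a, b⁆ = a * b * (b * a)⁻¹ := fun a b => by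
      rw [commutatorElement_def]
      group
    rw [hc, hc, g12, g21]
    group
  rw [key, commutatorElement_def]
  exact H.mul_mem (H.mul_mem (H.mul_mem hh₁ hh₂) (H.inv_mem hh₁)) (H.inv_mem hh₂)

end Connected

/-! ### Conjugates of algebraic subgroups -/

section Conj

variable {n : ℕ}

/-- `S` transported to the basis formed by the rows of `B`: the group `B⁻¹ S B`. -/
def inRows (B : Matrix.SpecialLinearGroup (Fin n) ℂ)
    (S : Subgroup (Matrix.SpecialLinearGroup (Fin n) ℂ)) :
    Subgroup (Matrix.SpecialLinearGroup (Fin n) ℂ) :=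
  S.map (MulAut.conj B⁻¹).toMonoidHom

theorem mem_inRows {B g : Matrix.SpecialLinearGroup (Fin n) ℂ}
    {S : Subgroup (Matrix.SpecialLinearGroup (Fin n) ℂ)} :
    g ∈ inRows B S ↔ B * g * B⁻¹ ∈ S := by
  rw [inRows]
  constructor
  · rintro ⟨s, hs, rfl⟩
    simpa [mul_assoc] using hs
  · intro h
    exact ⟨_, h, by simp [mul_assoc]⟩

/-- The rows of `B` are simultaneous eigenvectors of `g` exactly when `B g B⁻¹` is diagonal. -/
theorem conj_val_eq_diagonal {B g : Matrix.SpecialLinearGroup (Fin n) ℂ} {c : Fin n → ℂ}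
    (h : ∀ i, Matrix.vecMul (B.1 i) g.1 = c i • B.1 i) :
    (B * g * B⁻¹).1 = Matrix.diagonal c := by
  have h1 : B.1 * g.1 = Matrix.diagonal c * B.1 := by
    ext i j
    have := congrFun (h i) j
    rw [Matrix.diagonal_mul]
    simpa [Matrix.mul_apply, Matrix.vecMul, dotProduct] using this
  rw [Matrix.SpecialLinearGroup.coe_mul, Matrix.SpecialLinearGroup.coe_mul, h1, mul_assoc,
    ← Matrix.SpecialLinearGroup.coe_mul, mul_inv_cancel]
  simp

theorem vecMul_row_of_conj_val_eq_diagonal {B g : Matrix.SpecialLinearGroup (Fin n) ℂ}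
    {c : Fin n → ℂ} (h : (B * g * B⁻¹).1 = Matrix.diagonal c) (i : Fin n) :
    Matrix.vecMul (B.1 i) g.1 = c i • B.1 i := by
  have h1 : B.1 * g.1 = Matrix.diagonal c * B.1 := by
    rw [← h, ← Matrix.SpecialLinearGroup.coe_mul, ← Matrix.SpecialLinearGroup.coe_mul]
    simp [mul_assoc]
  ext j
  have := congrFun (congrFun h1 i) j
  rw [Matrix.diagonal_mul] at this
  simpa [Matrix.mul_apply, Matrix.vecMul, dotProduct] using this

theorem IsAlgebraicTorus.inRows {T : Subgroup (Matrix.SpecialLinearGroup (Fin n) ℂ)}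
    (hT : IsAlgebraicTorus T) (B : Matrix.SpecialLinearGroup (Fin n) ℂ) :
    IsAlgebraicTorus (inRows B T) := by
  obtain ⟨r, φ, hinj, hφ, rfl⟩ := hT
  refine ⟨r, (MulAut.conj B⁻¹).toMonoidHom.comp φ, (MulAut.conj B⁻¹).injective.comp hinj, ?_, ?_⟩
  · choose q hq using hφ
    intro i j
    refine ⟨∑ b, (∑ a, MvPolynomial.C ((B⁻¹).1 i a) * q a b) * MvPolynomial.C (B.1 b j),
      fun t => ?_⟩
    have h : ((MulAut.conj B⁻¹).toMonoidHom.comp φ t).1 = (B⁻¹).1 * (φ t).1 * B.1 := by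
      simp
    rw [h]
    simp only [Matrix.mul_apply, map_sum, map_mul, MvPolynomial.eval_C, ← hq]
  · rw [MonoidHom.range_comp]
    rfl

theorem IsAlgebraicSubgroup.inRows {H : Subgroup (Matrix.SpecialLinearGroup (Fin n) ℂ)}
    (hH : IsAlgebraicSubgroup H) (B : Matrix.SpecialLinearGroup (Fin n) ℂ) :
    IsAlgebraicSubgroup (inRows B H) := by
  obtain ⟨S, hS⟩ := hH
  let θ : MvPolynomial (Fin n × Fin n) ℂ → MvPolynomial (Fin n × Fin n) ℂ :=
    MvPolynomial.bind₁ fun ij => ∑ b, (∑ a, MvPolynomial.C (B.1 ij.1 a) * MvPolynomial.X (a, b)) *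
      MvPolynomial.C ((B⁻¹).1 b ij.2)
  have hθ : ∀ (q : MvPolynomial (Fin n × Fin n) ℂ) (g : Matrix.SpecialLinearGroup (Fin n) ℂ),
      MvPolynomial.eval (fun ij => g.1 ij.1 ij.2) (θ q) =
        MvPolynomial.eval (fun ij => (B * g * B⁻¹).1 ij.1 ij.2) q := by
    intro q g
    simp only [θ, MvPolynomial.eval, MvPolynomial.eval₂Hom_bind₁]
    congr 2
    funext ij
    simp only [Matrix.SpecialLinearGroup.coe_mul, Matrix.mul_apply]
    simp
  refine ⟨θ '' S, fun g => ?_⟩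
  rw [mem_inRows, hS]
  simp only [Set.forall_mem_image, hθ]

theorem IsAlgebraicSubgroup.isClosed {H : Subgroup (Matrix.SpecialLinearGroup (Fin n) ℂ)}
    (hH : IsAlgebraicSubgroup H) : IsClosed (H : Set (Matrix.SpecialLinearGroup (Fin n) ℂ)) := by
  obtain ⟨S, hS⟩ := hH
  have h : (H : Set (Matrix.SpecialLinearGroup (Fin n) ℂ)) =
      ⋂ q ∈ S, {g | MvPolynomial.eval (fun ij => g.1 ij.1 ij.2) q = 0} := by
    ext g
    simpa using hS g
  rw [h]
  refine isClosed_biInter fun q _ => isClosed_eq ?_ continuous_const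
  refine (MvPolynomial.continuous_eval q).comp (continuous_pi fun ij => ?_)
  fun_prop

theorem IsAlgebraicSubgroup.sigmaCompactSpace
    {H : Subgroup (Matrix.SpecialLinearGroup (Fin n) ℂ)} (hH : IsAlgebraicSubgroup H) :
    SigmaCompactSpace H := by
  have : SigmaCompactSpace (Matrix (Fin n) (Fin n) ℂ) :=
    inferInstanceAs (SigmaCompactSpace (Fin n → Fin n → ℂ))
  exact (Matrix.SpecialLinearGroup.isClosedEmbedding_val.comp
    hH.isClosed.isClosedEmbedding_subtypeVal).sigmaCompactSpace

end Conj

/-! ### The torus of a plane and a complementary line, and its centralizer -/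

section PlaneTorus

theorem det_diagonal_plane (t : ℂˣ) :
    (Matrix.diagonal ![(t : ℂ), t, (t : ℂ)⁻¹ ^ 2]).det = 1 := by
  simp [Matrix.det_diagonal, Fin.prod_univ_three]
  field_simp

/-- The matrix `diag(t, t, t⁻²)`. -/
noncomputable def planeDiag (t : ℂˣ) : Matrix.SpecialLinearGroup (Fin 3) ℂ :=
  ⟨Matrix.diagonal ![(t : ℂ), t, (t : ℂ)⁻¹ ^ 2], det_diagonal_plane t⟩

theorem planeDiag_coe (t : ℂˣ) :
    (planeDiag t).1 = Matrix.diagonal ![(t : ℂ), t, (t : ℂ)⁻¹ ^ 2] := rfl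

/-- The one-parameter subgroup `t ↦ diag(t, t, t⁻²)`. -/
noncomputable def planeTorusHom : ℂˣ →* Matrix.SpecialLinearGroup (Fin 3) ℂ where
  toFun := planeDiag
  map_one' := by
    refine Matrix.SpecialLinearGroup.ext _ _ fun i j => ?_
    rw [planeDiag_coe]
    fin_cases i <;> fin_cases j <;> simp
  map_mul' s t := by
    refine Matrix.SpecialLinearGroup.ext _ _ fun i j => ?_
    rw [Matrix.SpecialLinearGroup.coe_mul, planeDiag_coe, planeDiag_coe, planeDiag_coe,
      Matrix.diagonal_mul_diagonal]
    fin_cases i <;> fin_cases j <;> simp [mul_comm, mul_pow]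

/-- The torus of all `diag(t, t, t⁻²)`. -/
noncomputable def planeTorus : Subgroup (Matrix.SpecialLinearGroup (Fin 3) ℂ) :=
  planeTorusHom.range

/-- The block matrix with blocks `k` and `1`. -/
noncomputable def blockMatrix (k : Matrix.SpecialLinearGroup (Fin 2) ℂ) :
    Matrix.SpecialLinearGroup (Fin 3) ℂ :=
  ⟨!![k.1 0 0, k.1 0 1, 0; k.1 1 0, k.1 1 1, 0; 0, 0, 1], by
    have := k.2
    rw [Matrix.det_fin_two] at this
    simp [Matrix.det_fin_three, this]⟩

theorem blockMatrix_coe (k : Matrix.SpecialLinearGroup (Fin 2) ℂ) :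
    (blockMatrix k).1 = !![k.1 0 0, k.1 0 1, 0; k.1 1 0, k.1 1 1, 0; 0, 0, 1] := rfl

/-- The embedding of `SL(2, ℂ)` in `SL(3, ℂ)` as the upper left block. -/
noncomputable def blockHom :
    Matrix.SpecialLinearGroup (Fin 2) ℂ →* Matrix.SpecialLinearGroup (Fin 3) ℂ where
  toFun := blockMatrix
  map_one' := by
    refine Matrix.SpecialLinearGroup.ext _ _ fun i j => ?_
    rw [blockMatrix_coe]
    fin_cases i <;> fin_cases j <;> simp
  map_mul' k l := by
    refine Matrix.SpecialLinearGroup.ext _ _ fun i j => ?_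
    rw [Matrix.SpecialLinearGroup.coe_mul, blockMatrix_coe, blockMatrix_coe, blockMatrix_coe,
      Matrix.mul_apply, Fin.sum_univ_three, Matrix.SpecialLinearGroup.coe_mul]
    fin_cases i <;> fin_cases j <;> simp [Matrix.mul_apply, Fin.sum_univ_two]

theorem planeTorusHom_apply (t : ℂˣ) :
    (planeTorusHom t).1 = Matrix.diagonal ![(t : ℂ), t, (t : ℂ)⁻¹ ^ 2] := rfl

theorem blockHom_apply (k : Matrix.SpecialLinearGroup (Fin 2) ℂ) :
    (blockHom k).1 = !![k.1 0 0, k.1 0 1, 0; k.1 1 0, k.1 1 1, 0; 0, 0, 1] := rfl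

theorem blockHom_injective : Function.Injective blockHom := by
  intro k l h
  have h' := congrArg Subtype.val h
  rw [blockHom_apply, blockHom_apply] at h'
  ext i j
  fin_cases i <;> fin_cases j
  · simpa using congrFun (congrFun h' 0) 0
  · simpa using congrFun (congrFun h' 0) 1
  · simpa using congrFun (congrFun h' 1) 0
  · simpa using congrFun (congrFun h' 1) 1

theorem continuous_blockHom : Continuous blockHom := by
  refine continuous_specialLinearGroup_mk fun i j => ?_
  simp only [blockHom_apply]
  fin_cases i <;> fin_cases j <;> simp <;> fun_prop

theorem isAlgebraicTorus_planeTorus : IsAlgebraicTorus planeTorus := by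
  refine ⟨1, planeTorusHom.comp (Pi.evalMonoidHom (fun _ : Fin 1 => ℂˣ) 0), ?_, ?_, ?_⟩
  · intro s t h
    have h' := congrFun (congrFun (congrArg Subtype.val h) 0) 0
    funext i
    fin_cases i
    exact Units.ext (by simpa [planeTorusHom_apply] using h')
  · intro i j
    refine ⟨Matrix.diagonal ![MvPolynomial.X (Sum.inl 0), MvPolynomial.X (Sum.inl 0),
      MvPolynomial.X (Sum.inr 0) ^ 2] i j, fun t => ?_⟩
    fin_cases i <;> fin_cases j <;> simp [planeTorusHom_apply]
  · rw [MonoidHom.range_comp, MonoidHom.range_eq_top.mpr, planeTorus, MonoidHom.range_eq_map]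
    exact fun t => ⟨fun _ => t, rfl⟩

theorem mem_planeTorus_of_val_eq_diagonal {g : Matrix.SpecialLinearGroup (Fin 3) ℂ} {a b : ℂ}
    (h : g.1 = Matrix.diagonal ![a, a, b]) : g ∈ planeTorus := by
  have hdet := g.2
  rw [h, Matrix.det_diagonal] at hdet
  simp only [Fin.prod_univ_three, Matrix.cons_val] at hdet
  have ha : a ≠ 0 := by
    rintro rfl
    simp at hdet
  refine ⟨Units.mk0 a ha, Subtype.ext ?_⟩
  rw [planeTorusHom_apply, h]
  congr 3
  simp
  field_simp
  linear_combination -hdet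

theorem commute_blockHom_planeTorusHom (k : Matrix.SpecialLinearGroup (Fin 2) ℂ) (t : ℂˣ) :
    Commute (planeTorusHom t) (blockHom k) := by
  refine Subtype.ext ?_
  rw [Matrix.SpecialLinearGroup.coe_mul, Matrix.SpecialLinearGroup.coe_mul, planeTorusHom_apply,
    blockHom_apply]
  ext i j
  rw [Matrix.diagonal_mul, Matrix.mul_diagonal]
  fin_cases i <;> fin_cases j <;> simp [mul_comm]

/-- The centralizer of the torus consists of block matrices. -/
theorem exists_eq_blockHom_mul_planeTorusHom {g : Matrix.SpecialLinearGroup (Fin 3) ℂ}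
    (hg : g ∈ Subgroup.centralizer (planeTorus : Set (Matrix.SpecialLinearGroup (Fin 3) ℂ))) :
    ∃ k t, g = blockHom k * planeTorusHom t := by
  have hcomm := Subgroup.mem_centralizer_iff.mp hg (planeTorusHom (Units.mk0 2 two_ne_zero))
    ⟨_, rfl⟩
  have hentry : ∀ i j, ![(2 : ℂ), 2, 2⁻¹ ^ 2] i * g.1 i j = g.1 i j * ![(2 : ℂ), 2, 2⁻¹ ^ 2] j := by
    intro i j
    have h := congrFun (congrFun (congrArg Subtype.val hcomm) i) j
    simp only [Matrix.SpecialLinearGroup.coe_mul, planeTorusHom_apply, Units.val_mk0] at h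
    rwa [Matrix.diagonal_mul, Matrix.mul_diagonal] at h
  have h02 : g.1 0 2 = 0 := by
    have := hentry 0 2
    simp at this
    linear_combination (4 / 7) * this
  have h12 : g.1 1 2 = 0 := by
    have := hentry 1 2
    simp at this
    linear_combination (4 / 7) * this
  have h20 : g.1 2 0 = 0 := by
    have := hentry 2 0
    simp at this
    linear_combination (-4 / 7) * this
  have h21 : g.1 2 1 = 0 := by
    have := hentry 2 1
    simp at this
    linear_combination (-4 / 7) * this
  have hdet := g.2
  rw [Matrix.det_fin_three, h02, h12, h20, h21] at hdet
  obtain ⟨t, ht⟩ := IsAlgClosed.exists_pow_nat_eq (g.1 0 0 * g.1 1 1 - g.1 0 1 * g.1 1 0) two_pos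
  have ht0 : t ≠ 0 := by
    rintro rfl
    apply one_ne_zero (α := ℂ)
    rw [← hdet]
    linear_combination (-g.1 2 2) * ht
  obtain ⟨k, hk⟩ : ∃ k : Matrix.SpecialLinearGroup (Fin 2) ℂ,
      k.1 = !![g.1 0 0 / t, g.1 0 1 / t; g.1 1 0 / t, g.1 1 1 / t] := by
    refine ⟨⟨_, ?_⟩, rfl⟩
    rw [Matrix.det_fin_two_of]
    field_simp
    linear_combination -ht
  refine ⟨k, Units.mk0 t ht0, Matrix.SpecialLinearGroup.ext _ _ fun i j => ?_⟩
  rw [Matrix.SpecialLinearGroup.coe_mul, planeTorusHom_apply, blockHom_apply,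
    Matrix.mul_diagonal, hk]
  fin_cases i <;> fin_cases j <;> simp [ht0, h02, h12, h20, h21]
  field_simp
  linear_combination hdet + g.1 2 2 * ht

theorem finite_blockHom_range_inf_planeTorus :
    Finite (blockHom.range ⊓ planeTorus : Subgroup (Matrix.SpecialLinearGroup (Fin 3) ℂ)) := by
  have hroots : {t : ℂˣ | t ^ 2 = 1}.Finite := by
    have : Finite (rootsOfUnity 2 ℂ) := inferInstance
    exact (Set.finite_coe_iff.mp this).subset fun t ht => (mem_rootsOfUnity 2 t).mpr ht
  refine (hroots.image planeTorusHom).subset ?_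
  rintro _ ⟨⟨k, hk⟩, ⟨t, rfl⟩⟩
  refine ⟨t, ?_, rfl⟩
  have h := congrFun (congrFun (congrArg Subtype.val hk) 2) 2
  have h' : (t : ℂ) ^ 2 = 1 := by simpa [blockHom_apply, planeTorusHom_apply] using h.symm
  exact Units.ext (by simpa using h')

theorem isAlgebraicSubgroup_range_blockHom : IsAlgebraicSubgroup blockHom.range := by
  refine ⟨{MvPolynomial.X (0, 2), MvPolynomial.X (1, 2), MvPolynomial.X (2, 0),
    MvPolynomial.X (2, 1), MvPolynomial.X (2, 2) - 1}, fun g => ?_⟩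
  simp only [Set.mem_insert_iff, Set.mem_singleton_iff, forall_eq_or_imp, forall_eq,
    MvPolynomial.eval_X, map_sub, map_one, sub_eq_zero]
  constructor
  · rintro ⟨k, rfl⟩
    simp [blockHom_apply]
  · rintro ⟨h02, h12, h20, h21, h22⟩
    have hdet := g.2
    rw [Matrix.det_fin_three, h02, h12, h20, h21, h22] at hdet
    obtain ⟨k, hk⟩ : ∃ k : Matrix.SpecialLinearGroup (Fin 2) ℂ,
        k.1 = !![g.1 0 0, g.1 0 1; g.1 1 0, g.1 1 1] := by
      refine ⟨⟨_, ?_⟩, rfl⟩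
      rw [Matrix.det_fin_two_of]
      linear_combination hdet
    refine ⟨k, Matrix.SpecialLinearGroup.ext _ _ fun i j => ?_⟩
    rw [blockHom_apply, hk]
    fin_cases i <;> fin_cases j <;> simp [h02, h12, h20, h21, h22]

end PlaneTorus

/-! ### Stability under lifts for the torus of a plane and a line -/

section PlaneLift

variable (B : Matrix.SpecialLinearGroup (Fin 3) ℂ)

/-- The embedding of `SL(2, ℂ)` in `SL(3, ℂ)` that acts on the first two rows of `B`
and fixes the third. -/
noncomputable def rowBlockHom :
    Matrix.SpecialLinearGroup (Fin 2) ℂ →* Matrix.SpecialLinearGroup (Fin 3) ℂ :=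
  (MulAut.conj B⁻¹).toMonoidHom.comp blockHom

theorem rowBlockHom_apply (k : Matrix.SpecialLinearGroup (Fin 2) ℂ) :
    rowBlockHom B k = B⁻¹ * blockHom k * B := by
  simp [rowBlockHom]

theorem rowBlockHom_range : (rowBlockHom B).range = inRows B blockHom.range :=
  MonoidHom.range_comp _ _

theorem rowBlockHom_injective : Function.Injective (rowBlockHom B) :=
  (MulAut.conj B⁻¹).injective.comp blockHom_injective

theorem continuous_rowBlockHom : Continuous (rowBlockHom B) := by
  have h : (rowBlockHom B : _ → _) = fun k => B⁻¹ * blockHom k * B :=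
    funext (rowBlockHom_apply B)
  rw [h]
  exact (continuous_const.mul continuous_blockHom).mul continuous_const

variable {B}

theorem mul_comm_of_mem_range_of_mem_planeTorus {k t : Matrix.SpecialLinearGroup (Fin 3) ℂ}
    (hk : k ∈ (rowBlockHom B).range) (ht : t ∈ inRows B planeTorus) : t * k = k * t := by
  obtain ⟨k, rfl⟩ := hk
  obtain ⟨_, ⟨t, rfl⟩, rfl⟩ := ht
  exact ((commute_blockHom_planeTorusHom k t).map (MulAut.conj B⁻¹).toMonoidHom).eq

theorem exists_eq_mul_of_mem_centralizer_planeTorus {g : Matrix.SpecialLinearGroup (Fin 3) ℂ}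
    (hg : g ∈ Subgroup.centralizer (inRows B planeTorus : Set _)) :
    ∃ k ∈ (rowBlockHom B).range, ∃ t ∈ inRows B planeTorus, g = k * t := by
  have hg' : B * g * B⁻¹ ∈ Subgroup.centralizer (planeTorus : Set _) := by
    refine Subgroup.mem_centralizer_iff.mpr fun t ht => ?_
    have h := Subgroup.mem_centralizer_iff.mp hg (B⁻¹ * t * B) (mem_inRows.mpr (by
      simpa [mul_assoc] using ht))
    have h' := congrArg (fun x => B * x * B⁻¹) h
    simpa [mul_assoc] using h'
  obtain ⟨k, t, hkt⟩ := exists_eq_blockHom_mul_planeTorusHom hg'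
  refine ⟨_, ⟨k, rfl⟩, _, ⟨_, ⟨t, rfl⟩, rfl⟩, ?_⟩
  have h : g = (MulAut.conj B⁻¹).toMonoidHom (B * g * B⁻¹) := by simp [mul_assoc]
  rw [h, hkt, map_mul]
  rfl

theorem range_le_connectedCentralizer_planeTorus :
    (rowBlockHom B).range ≤ connectedCentralizer (inRows B planeTorus) :=
  range_le_connectedCentralizer (continuous_rowBlockHom B) fun _ hk =>
    Subgroup.mem_centralizer_iff.mpr fun _ ht => mul_comm_of_mem_range_of_mem_planeTorus hk ht

variable (B) in
theorem isQuotientLift_range_rowBlockHom :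
    IsQuotientLift (inRows B planeTorus) (rowBlockHom B).range where
  algebraic := by
    rw [rowBlockHom_range]
    exact isAlgebraicSubgroup_range_blockHom.inRows B
  le_centralizer := range_le_connectedCentralizer_planeTorus
  surjective := fun _ hz =>
    exists_eq_mul_of_mem_centralizer_planeTorus (connectedCentralizer_le_centralizer hz)
  finite_kernel := by
    rw [rowBlockHom_range, inRows, inRows, ← Subgroup.map_inf _ _ _ (MulAut.conj B⁻¹).injective]
    have := finite_blockHom_range_inf_planeTorus
    exact (Set.finite_coe_iff.mp this).image _

/-- Since `SL(2, ℂ)` is perfect, each lift contains the block `SL(2, ℂ)`. -/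
theorem range_rowBlockHom_le {H : Subgroup (Matrix.SpecialLinearGroup (Fin 3) ℂ)}
    (h : IsQuotientLift (inRows B planeTorus) H) : (rowBlockHom B).range ≤ H := by
  have hperf : commutator (Matrix.SpecialLinearGroup (Fin 2) ℂ) = ⊤ :=
    Matrix.SL2.commutator_eq_top (a := 2) two_ne_zero (by norm_num)
  have hrange : (rowBlockHom B).range = ⁅(rowBlockHom B).range, (rowBlockHom B).range⁆ := by
    rw [MonoidHom.range_eq_map, ← Subgroup.map_commutator, ← commutator_def, hperf]
  rw [hrange]
  exact (Subgroup.commutator_mono range_le_connectedCentralizer_planeTorus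
    range_le_connectedCentralizer_planeTorus).trans h.commutator_connectedCentralizer_le

theorem finiteIndex_range_rowBlockHom {H : Subgroup (Matrix.SpecialLinearGroup (Fin 3) ℂ)}
    (h : IsQuotientLift (inRows B planeTorus) H) :
    ((rowBlockHom B).range.subgroupOf H).FiniteIndex := by
  have hle := range_rowBlockHom_le h
  have := h.finite_kernel
  let q : (H ⊓ inRows B planeTorus : Subgroup _) → H ⧸ (rowBlockHom B).range.subgroupOf H :=
    fun t => ((⟨t.1, t.2.1⟩ : H) : H ⧸ (rowBlockHom B).range.subgroupOf H)
  have hq : Function.Surjective q := by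
    intro x
    obtain ⟨g, rfl⟩ := QuotientGroup.mk_surjective x
    obtain ⟨k, hk, t, ht, hkt⟩ := exists_eq_mul_of_mem_centralizer_planeTorus
      (connectedCentralizer_le_centralizer (h.le_centralizer g.2))
    have htH : t ∈ H := by
      have : t = k⁻¹ * g := by rw [hkt, inv_mul_cancel_left]
      rw [this]
      exact H.mul_mem (H.inv_mem (hle hk)) g.2
    refine ⟨⟨t, htH, ht⟩, QuotientGroup.eq.mpr ?_⟩
    change t⁻¹ * (g : Matrix.SpecialLinearGroup (Fin 3) ℂ) ∈ (rowBlockHom B).range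
    rw [hkt, ← mul_comm_of_mem_range_of_mem_planeTorus hk ht, inv_mul_cancel_left]
    exact hk
  have := Finite.of_surjective q hq
  exact Subgroup.finiteIndex_of_finite_quotient

/-- Stability under a lift does not depend on the lift: all are finite extensions of `SL(2, ℂ)`. -/
theorem isStable_iff_isStable_range_rowBlockHom {d : ℕ} {f : Form 3 d}
    {H : Subgroup (Matrix.SpecialLinearGroup (Fin 3) ℂ)}
    (h : IsQuotientLift (inRows B planeTorus) H) :
    GIT.IsStable H f ↔ GIT.IsStable (rowBlockHom B).range f := by
  have := finiteIndex_range_rowBlockHom h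
  have := h.algebraic.sigmaCompactSpace
  exact GIT.isStable_iff_of_finiteIndex (range_rowBlockHom_le h)
    (isQuotientLift_range_rowBlockHom B).algebraic.isClosed Form.smul_zero'

end PlaneLift

/-! ### Binary forms inside ternary forms -/

namespace GIT

/-- Stability is preserved by an equivariant closed embedding. -/
theorem isStable_range_iff {G G' V W : Type*} [Group G] [Group G'] [TopologicalSpace V]
    [TopologicalSpace W] [Zero V] [Zero W] [MulAction G V] [MulAction G' W] {j : G →* G'}
    (hj : Function.Injective j) {Φ : V → W} (hΦ : Topology.IsClosedEmbedding Φ) (h0 : Φ 0 = 0)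
    (hequiv : ∀ g v, Φ (g • v) = j g • Φ v) (v : V) :
    IsStable j.range (Φ v) ↔ IsStable (⊤ : Subgroup G) v := by
  have horbit : MulAction.orbit j.range (Φ v) = Φ '' MulAction.orbit (⊤ : Subgroup G) v := by
    ext w
    rw [mem_orbit_subgroup]
    constructor
    · rintro ⟨_, ⟨g, rfl⟩, rfl⟩
      exact ⟨g • v, ⟨⟨g, trivial⟩, rfl⟩, hequiv g v⟩
    · rintro ⟨_, ⟨g, rfl⟩, rfl⟩
      exact ⟨j g.1, ⟨g.1, rfl⟩, (hequiv g.1 v).symm⟩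
  have hzero : (0 : W) ∈ Φ '' MulAction.orbit (⊤ : Subgroup G) v ↔
      (0 : V) ∈ MulAction.orbit (⊤ : Subgroup G) v := by
    rw [← h0]
    exact hΦ.injective.mem_set_image
  have hstab : Finite (MulAction.stabilizer j.range (Φ v)) ↔
      Finite (MulAction.stabilizer (⊤ : Subgroup G) v) := by
    have hfix : ∀ g : G, j g • Φ v = Φ v ↔ g • v = v := fun g => by
      rw [← hequiv, hΦ.injective.eq_iff]
    let F : MulAction.stabilizer (⊤ : Subgroup G) v → MulAction.stabilizer j.range (Φ v) :=
      fun g => ⟨⟨j g.1.1, ⟨g.1.1, rfl⟩⟩, (hfix g.1.1).mpr g.2⟩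
    have hF : Function.Bijective F := by
      constructor
      · intro a b hab
        exact Subtype.ext (Subtype.ext (hj (congrArg (fun x => x.1.1) hab)))
      · rintro ⟨⟨_, g, rfl⟩, hg⟩
        exact ⟨⟨⟨g, trivial⟩, (hfix g).mp hg⟩, rfl⟩
    exact (Equiv.ofBijective F hF).finite_iff.symm
  unfold IsStable IsPolystable
  rw [horbit, hzero, hstab, hΦ.isClosed_iff_image_isClosed]

end GIT

section Extend

variable (B : Matrix.SpecialLinearGroup (Fin 3) ℂ)

theorem linearForm_isHomogeneous {n : ℕ} (v : Fin n → ℂ) : (linearForm v).IsHomogeneous 1 :=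
  MvPolynomial.IsHomogeneous.sum _ _ _ fun i _ => by
    simpa using (MvPolynomial.isHomogeneous_C (Fin n) (v i)).mul
      (MvPolynomial.isHomogeneous_X ℂ i)

/-- The linear map `g ↦ a l₂^e g(l₀, l₁)` from binary to ternary forms, where the linear forms
`lᵢ` are given by the rows of `B`. -/
noncomputable def extendForm (a : ℂ) {e d' d : ℕ} (hd : e + d' = d) : Form 2 d' →ₗ[ℂ] Form 3 d where
  toFun g := ⟨MvPolynomial.C a * linearForm (B.1 2) ^ e *
      MvPolynomial.aeval ![linearForm (B.1 0), linearForm (B.1 1)] g.1, by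
    have h1 := (linearForm_isHomogeneous (B.1 2)).pow e
    have h2 := g.2.aeval (![linearForm (B.1 0), linearForm (B.1 1)]) (n := 1) (fun i => by
      fin_cases i
      · exact linearForm_isHomogeneous _
      · exact linearForm_isHomogeneous _)
    have h3 := ((MvPolynomial.isHomogeneous_C (Fin 3) a).mul h1).mul h2
    simpa [hd] using h3⟩
  map_add' g h := Subtype.ext (by simp [mul_add])
  map_smul' c g := Subtype.ext (by simp)

theorem eval_extendForm (a : ℂ) {e d' d : ℕ} (hd : e + d' = d) (g : Form 2 d') (x : Fin 3 → ℂ) :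
    MvPolynomial.eval x (extendForm B a hd g).1 =
      a * (B.1 2 ⬝ᵥ x) ^ e * MvPolynomial.eval ![B.1 0 ⬝ᵥ x, B.1 1 ⬝ᵥ x] g.1 := by
  have h : ∀ q : MvPolynomial (Fin 2) ℂ, MvPolynomial.eval x
      (MvPolynomial.aeval ![linearForm (B.1 0), linearForm (B.1 1)] q) =
        MvPolynomial.eval ![B.1 0 ⬝ᵥ x, B.1 1 ⬝ᵥ x] q := by
    intro q
    induction q using MvPolynomial.induction_on with
    | C a => simp
    | add p q hp hq => simp only [map_add, hp, hq]
    | mul_X p i hp =>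
      rw [map_mul, map_mul, map_mul, hp, MvPolynomial.aeval_X, MvPolynomial.eval_X]
      fin_cases i <;> simp [eval_linearForm]
  change MvPolynomial.eval x (MvPolynomial.C a * linearForm (B.1 2) ^ e *
      MvPolynomial.aeval ![linearForm (B.1 0), linearForm (B.1 1)] g.1) = _
  rw [map_mul, map_mul, map_pow, h, MvPolynomial.eval_C]
  simp [eval_linearForm]

theorem extendForm_injective {a : ℂ} (ha : a ≠ 0) {e d' d : ℕ} (hd : e + d' = d) :
    Function.Injective (extendForm B a hd) := by
  intro g h hgh
  have hmul : ∀ y : Fin 3 → ℂ, y 2 ≠ 0 →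
      MvPolynomial.eval ![y 0, y 1] g.1 = MvPolynomial.eval ![y 0, y 1] h.1 := by
    intro y hy
    have hx : B.1.mulVec ((B⁻¹).1.mulVec y) = y := by
      rw [Matrix.mulVec_mulVec, ← Matrix.SpecialLinearGroup.coe_mul, mul_inv_cancel]
      simp
    have hrow : ∀ i, B.1 i ⬝ᵥ (B⁻¹).1.mulVec y = y i := fun i => congrFun hx i
    have := congrArg (fun f : Form 3 d => MvPolynomial.eval ((B⁻¹).1.mulVec y) f.1) hgh
    simp only [eval_extendForm, hrow] at this
    exact mul_left_cancel₀ (mul_ne_zero ha (pow_ne_zero _ hy)) this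
  refine Form.ext_eval fun x => ?_
  have h := hmul ![x 0, x 1, 1] (by simp)
  have hx : ![x 0, x 1] = x := by
    ext i
    fin_cases i <;> rfl
  simpa [hx] using h

theorem extendForm_smul (a : ℂ) {e d' d : ℕ} (hd : e + d' = d)
    (k : Matrix.SpecialLinearGroup (Fin 2) ℂ) (g : Form 2 d') :
    extendForm B a hd (k • g) = rowBlockHom B k • extendForm B a hd g := by
  refine Form.ext_eval fun x => ?_
  rw [Form.eval_smul, eval_extendForm, eval_extendForm, Form.eval_smul, ← map_inv,
    rowBlockHom_apply]
  generalize k⁻¹ = l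
  have hx : B.1.mulVec ((B⁻¹ * blockHom l * B).1.mulVec x) =
      (blockHom l).1.mulVec (B.1.mulVec x) := by
    rw [Matrix.mulVec_mulVec, Matrix.mulVec_mulVec, ← Matrix.SpecialLinearGroup.coe_mul,
      ← Matrix.SpecialLinearGroup.coe_mul]
    have h : B * (B⁻¹ * blockHom l * B) = blockHom l * B := by
      rw [← mul_assoc, ← mul_assoc, mul_inv_cancel, one_mul]
    rw [h]
  have hrow : ∀ i, B.1 i ⬝ᵥ (B⁻¹ * blockHom l * B).1.mulVec x =
      (blockHom l).1.mulVec (fun i => B.1 i ⬝ᵥ x) i := fun i => congrFun hx i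
  rw [hrow, hrow, hrow, blockHom_apply]
  congr 2
  · simp [Matrix.mulVec, dotProduct, Fin.sum_univ_three]
  · congr 1
    ext i
    fin_cases i <;> simp [Matrix.mulVec, dotProduct, Fin.sum_univ_three, Fin.sum_univ_two]

theorem isStable_extendForm_iff {a : ℂ} (ha : a ≠ 0) {e d' d : ℕ} (hd : e + d' = d)
    (g : Form 2 d') :
    GIT.IsStable (rowBlockHom B).range (extendForm B a hd g) ↔
      GIT.IsStable (⊤ : Subgroup (Matrix.SpecialLinearGroup (Fin 2) ℂ)) g :=
  GIT.isStable_range_iff (rowBlockHom_injective B)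
    (LinearMap.isClosedEmbedding_of_injective
      (LinearMap.ker_eq_bot.mpr (extendForm_injective B ha hd)))
    (map_zero _) (extendForm_smul B a hd) g

end Extend

/-! ### Choices of maximal tori and lifts -/

section Choices

variable {n : ℕ}

theorem isAlgebraicTorus_bot :
    IsAlgebraicTorus (⊥ : Subgroup (Matrix.SpecialLinearGroup (Fin n) ℂ)) := by
  refine ⟨0, 1, Function.injective_of_subsingleton _, fun i j => ?_, ?_⟩
  · exact ⟨MvPolynomial.C ((1 : Matrix (Fin n) (Fin n) ℂ) i j), fun t => by simp⟩
  · exact MonoidHom.range_one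

/-- If stability under a lift is equivalent to a fixed condition for all choices, and some choice
exists, then relative stability is equivalent to that condition. -/
theorem isRelativelyStable_iff_of_forall_lift {d : ℕ} {f : Form n d} {P : Prop}
    (hiff : ∀ T H, IsMaximalTorusOfStabilizer f T → IsQuotientLift T H → (GIT.IsStable H f ↔ P))
    (hex : ∃ T H, IsMaximalTorusOfStabilizer f T ∧ IsQuotientLift T H) :
    (IsRelativelyStable f ↔ P) ∧
      ∀ T H, IsMaximalTorusOfStabilizer f T → IsQuotientLift T H →
        (GIT.IsStable H f ↔ IsRelativelyStable f) := by
  have h : IsRelativelyStable f ↔ P := by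
    constructor
    · rintro ⟨T, H, hT, hH, hs⟩
      exact (hiff T H hT hH).mp hs
    · intro hP
      obtain ⟨T, H, hT, hH⟩ := hex
      exact ⟨T, H, hT, hH, (hiff T H hT hH).mpr hP⟩
  exact ⟨h, fun T H hT hH => (hiff T H hT hH).trans h.symm⟩

/-- Three independent row vectors are, up to a scalar on the last, the rows of a matrix of
determinant one. -/
theorem exists_specialLinearGroup_rows {u v w : Fin 3 → ℂ}
    (h : LinearIndependent ℂ ![u, v, w]) :
    ∃ (B : Matrix.SpecialLinearGroup (Fin 3) ℂ) (c : ℂ), c ≠ 0 ∧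
      B.1 0 = u ∧ B.1 1 = v ∧ B.1 2 = c • w := by
  have hdet : (Matrix.of ![u, v, w]).det ≠ 0 := by
    have := (Matrix.linearIndependent_rows_iff_isUnit (A := Matrix.of ![u, v, w])).mp h
    exact ((Matrix.isUnit_iff_isUnit_det _).mp this).ne_zero
  refine ⟨⟨Matrix.of ![u, v, (Matrix.of ![u, v, w]).det⁻¹ • w], ?_⟩, _, inv_ne_zero hdet,
    rfl, rfl, rfl⟩
  have : Matrix.of ![u, v, (Matrix.of ![u, v, w]).det⁻¹ • w] =
      (Matrix.of ![u, v, w]).updateRow 2 ((Matrix.of ![u, v, w]).det⁻¹ • w) := by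
    ext i j
    fin_cases i <;> simp [Matrix.updateRow_apply]
  rw [this, Matrix.det_updateRow_smul]
  have h2 : (Matrix.of ![u, v, w]).updateRow 2 w = Matrix.of ![u, v, w] := by
    ext i j
    fin_cases i <;> simp [Matrix.updateRow_apply]
  rw [h2, inv_mul_cancel₀ hdet]

theorem vecMul_row_conj (B M : Matrix.SpecialLinearGroup (Fin n) ℂ) (i : Fin n) :
    Matrix.vecMul (B.1 i) (B⁻¹ * M * B).1 = Matrix.vecMul (M.1 i) B.1 := by
  have h : B.1 * (B⁻¹ * M * B).1 = M.1 * B.1 := by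
    rw [← Matrix.SpecialLinearGroup.coe_mul, ← Matrix.SpecialLinearGroup.coe_mul]
    simp [mul_assoc]
  exact congrFun h i

end Choices

/-! ### Three points on a line -/

section Plane

variable {L : Submodule ℂ (Fin 3 → ℂ)} {B : Matrix.SpecialLinearGroup (Fin 3) ℂ}

/-- A linear map with three eigenlines in a plane is a homothety of the plane. -/
theorem exists_forall_vecMul_eq_smul (hL : Module.finrank ℂ L = 2) {a b c : Fin 3 → ℂ}
    (ha : a ∈ L) (hb : b ∈ L) (hc : c ∈ L) (hab : LinearIndependent ℂ ![a, b])
    (hac : LinearIndependent ℂ ![a, c]) (hbc : LinearIndependent ℂ ![b, c])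
    {g : Matrix.SpecialLinearGroup (Fin 3) ℂ} (hga : g ∈ rowStabilizer a)
    (hgb : g ∈ rowStabilizer b) (hgc : g ∈ rowStabilizer c) :
    ∃ r : ℂ, ∀ x ∈ L, Matrix.vecMul x g.1 = r • x := by
  have hspan : Submodule.span ℂ {a, b} = L := by
    have hle : Submodule.span ℂ {a, b} ≤ L := by
      rw [Submodule.span_le]
      rintro x (rfl | rfl)
      exacts [ha, hb]
    refine Submodule.eq_of_le_of_finrank_eq hle ?_
    have := finrank_span_eq_card hab
    rw [Matrix.range_cons, Matrix.range_cons, Matrix.range_empty, Set.union_empty,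
      Set.singleton_union] at this
    rw [this, hL, Fintype.card_fin]
  rw [← hspan, Submodule.mem_span_pair] at hc
  obtain ⟨x, y, hxy⟩ := hc
  have hx : x ≠ 0 := by
    rintro rfl
    have := LinearIndependent.pair_iff.mp hbc y (-1) (by rw [← hxy]; simp)
    simpa using this.2
  have hy : y ≠ 0 := by
    rintro rfl
    have := LinearIndependent.pair_iff.mp hac x (-1) (by rw [← hxy]; simp)
    simpa using this.2
  obtain ⟨r, hr⟩ := hga
  obtain ⟨r', hr'⟩ := hgb
  obtain ⟨r'', hr''⟩ := hgc
  simp only [Units.smul_def] at hr hr' hr''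
  rw [← hxy, Matrix.add_vecMul, Matrix.smul_vecMul, Matrix.smul_vecMul, hr, hr'] at hr''
  have h0 := LinearIndependent.pair_iff.mp hab (x * r - r'' * x) (y * r' - r'' * y) (by
    simp only [sub_smul, mul_smul]
    rw [smul_add] at hr''
    linear_combination (exp := 1) hr'')
  have e1 : (r : ℂ) = r'' := mul_left_cancel₀ hx (by linear_combination h0.1)
  have e2 : (r' : ℂ) = r'' := mul_left_cancel₀ hy (by linear_combination h0.2)
  refine ⟨r'', fun z hz => ?_⟩
  rw [← hspan, Submodule.mem_span_pair] at hz
  obtain ⟨x', y', rfl⟩ := hz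
  rw [Matrix.add_vecMul, Matrix.smul_vecMul, Matrix.smul_vecMul, hr, hr', e1, e2, smul_add,
    smul_comm, smul_comm y']

theorem mem_planeTorus_of_vecMul {g : Matrix.SpecialLinearGroup (Fin 3) ℂ} {r : ℂ}
    (h0 : Matrix.vecMul (B.1 0) g.1 = r • B.1 0) (h1 : Matrix.vecMul (B.1 1) g.1 = r • B.1 1)
    (h2 : g ∈ rowStabilizer (B.1 2)) : g ∈ inRows B planeTorus := by
  obtain ⟨r', h2⟩ := h2
  refine mem_inRows.mpr (mem_planeTorus_of_val_eq_diagonal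
    (conj_val_eq_diagonal (c := ![r, r, r']) fun i => ?_))
  fin_cases i
  exacts [h0, h1, h2]

/-- Elements of the torus are homotheties on the plane and have the last row of `B` as an
eigenvector. -/
theorem exists_vecMul_of_mem_planeTorus {g : Matrix.SpecialLinearGroup (Fin 3) ℂ}
    (hg : g ∈ inRows B planeTorus) :
    ∃ r : ℂ, Matrix.vecMul (B.1 0) g.1 = r • B.1 0 ∧ Matrix.vecMul (B.1 1) g.1 = r • B.1 1 ∧
      g ∈ rowStabilizer (B.1 2) := by
  obtain ⟨t, ht⟩ := mem_inRows.mp hg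
  have h := vecMul_row_of_conj_val_eq_diagonal (B := B) (g := g)
    (c := ![(t : ℂ), t, (t : ℂ)⁻¹ ^ 2]) (by rw [← ht]; rfl)
  exact ⟨t, h 0, h 1, mem_rowStabilizer_of_eq_smul (h 2)⟩

theorem mem_rowStabilizer_of_mem_centralizer_planeTorus
    {g : Matrix.SpecialLinearGroup (Fin 3) ℂ}
    (hg : g ∈ Subgroup.centralizer (inRows B planeTorus : Set _)) :
    g ∈ rowStabilizer (B.1 2) := by
  obtain ⟨_, ⟨k, rfl⟩, t, ht, rfl⟩ := exists_eq_mul_of_mem_centralizer_planeTorus hg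
  refine Subgroup.mul_mem _ ⟨1, ?_⟩ (exists_vecMul_of_mem_planeTorus ht).choose_spec.2.2
  rw [rowBlockHom_apply, vecMul_row_conj, blockHom_apply, one_smul]
  ext j
  simp [Matrix.vecMul, dotProduct, Fin.sum_univ_three]

theorem linearIndependent_rep_pair {p q : ℙ ℂ (Fin 3 → ℂ)} (h : p ≠ q) :
    LinearIndependent ℂ ![p.rep, q.rep] := by
  have := Projectivization.independent_iff.mp (Projectivization.independent_pair_iff_ne p q |>.mpr h)
  have h' : Projectivization.rep ∘ ![p, q] = ![p.rep, q.rep] := by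
    ext1 i
    fin_cases i <;> rfl
  rwa [h'] at this

variable {s : ℕ} {p : Fin s → ℙ ℂ (Fin 3 → ℂ)} {m : Fin s → ℕ}

theorem exists_forall_vecMul_eq_smul_of_subset_lineStabilizer (hp : Function.Injective p)
    (hm : ∀ j, 0 < m j) (hL : Module.finrank ℂ L = 2) {a b c : Fin s} (hab : a ≠ b) (hac : a ≠ c)
    (hbc : b ≠ c) (ha : (p a).rep ∈ L) (hb : (p b).rep ∈ L) (hc : (p c).rep ∈ L)
    {T : Subgroup (Matrix.SpecialLinearGroup (Fin 3) ℂ)} (hT : IsAlgebraicTorus T)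
    (hTf : (T : Set _) ⊆ lineStabilizer (chowForm p m)) {g : Matrix.SpecialLinearGroup (Fin 3) ℂ}
    (hg : g ∈ T) : ∃ r : ℂ, ∀ x ∈ L, Matrix.vecMul x g.1 = r • x := by
  have h := (hT.subset_lineStabilizer_chowForm_iff hp hm).mp hTf
  exact exists_forall_vecMul_eq_smul hL ha hb hc (linearIndependent_rep_pair (hp.ne hab))
    (linearIndependent_rep_pair (hp.ne hac)) (linearIndependent_rep_pair (hp.ne hbc))
    (h a hg) (h b hg) (h c hg)

theorem linearIndependent_of_notMem (hL : Module.finrank ℂ L = 2) {u v w : Fin 3 → ℂ}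
    (hspan : Submodule.span ℂ {u, v} = L) (hw : w ∉ L) : LinearIndependent ℂ ![u, v, w] := by
  have huv : LinearIndependent ℂ ![u, v] := by
    rw [linearIndependent_iff_card_eq_finrank_span]
    rw [Set.finrank, Matrix.range_cons, Matrix.range_cons, Matrix.range_empty, Set.union_empty,
      Set.singleton_union, hspan, hL, Fintype.card_fin]
  rw [linearIndependent_finSucc']
  have hinit : Fin.init ![u, v, w] = ![u, v] := by
    ext1 i
    fin_cases i <;> rfl
  rw [hinit]
  refine ⟨huv, ?_⟩
  rw [Matrix.range_cons, Matrix.range_cons, Matrix.range_empty, Set.union_empty,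
    Set.singleton_union, hspan]
  exact hw

/-- The configurations with at least three points on a line and at most one point off it.
Every maximal torus acts by homotheties on the plane over the line, so it is determined by an
eigenvector `w` off the plane, and the form is a binary form times a power of the linear
form of `w`. -/
theorem isRelativelyStable_iff_of_plane (hp : Function.Injective p)
    (hm : ∀ j, 0 < m j) (hL : Module.finrank ℂ L = 2) {a b c : Fin s} (hab : a ≠ b) (hac : a ≠ c)
    (hbc : b ≠ c) (ha : (p a).rep ∈ L) (hb : (p b).rep ∈ L) (hc : (p c).rep ∈ L)
    {u v : Fin 3 → ℂ} (hspan : Submodule.span ℂ {u, v} = L) {d' : ℕ} (g : Form 2 d')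
    (hw : ∀ T : Subgroup (Matrix.SpecialLinearGroup (Fin 3) ℂ), IsAlgebraicTorus T →
      (T : Set _) ⊆ lineStabilizer (chowForm p m) →
      ∃ w, w ∉ L ∧ T ≤ rowStabilizer w ∧ ∀ j, (p j).rep ∈ L ∨ ∃ r : ℂ, (p j).rep = r • w)
    (hf : ∀ B : Matrix.SpecialLinearGroup (Fin 3) ℂ, B.1 0 = u → B.1 1 = v →
      (∀ j, (p j).rep ∈ L ∨ ∃ r : ℂ, (p j).rep = r • B.1 2) →
      ∃ (e : ℂ) (k : ℕ) (hd : k + d' = ∑ j, m j), e ≠ 0 ∧ chowForm p m = extendForm B e hd g) :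
    (IsRelativelyStable (chowForm p m) ↔
        GIT.IsStable (⊤ : Subgroup (Matrix.SpecialLinearGroup (Fin 2) ℂ)) g) ∧
      ∀ T H, IsMaximalTorusOfStabilizer (chowForm p m) T → IsQuotientLift T H →
        (GIT.IsStable H (chowForm p m) ↔ IsRelativelyStable (chowForm p m)) := by
  have hu : u ∈ L := hspan ▸ Submodule.subset_span (by simp)
  have hv : v ∈ L := hspan ▸ Submodule.subset_span (by simp)
  -- a torus with eigenvector `w` lies in the torus of `L` and `w`, which stabilizes the form
  have hrows : ∀ T : Subgroup (Matrix.SpecialLinearGroup (Fin 3) ℂ), IsAlgebraicTorus T →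
      (T : Set _) ⊆ lineStabilizer (chowForm p m) →
      ∃ B : Matrix.SpecialLinearGroup (Fin 3) ℂ, B.1 0 = u ∧ B.1 1 = v ∧
        (∀ j, (p j).rep ∈ L ∨ ∃ r : ℂ, (p j).rep = r • B.1 2) ∧ T ≤ inRows B planeTorus := by
    intro T hT hTf
    obtain ⟨w, hwL, hTw, hpw⟩ := hw T hT hTf
    obtain ⟨B, x, hx, h0, h1, h2⟩ :=
      exists_specialLinearGroup_rows (linearIndependent_of_notMem hL hspan hwL)
    refine ⟨B, h0, h1, fun j => (hpw j).imp_right ?_, fun t ht => ?_⟩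
    · rintro ⟨r, hr⟩
      refine ⟨r * x⁻¹, ?_⟩
      rw [h2, smul_smul, mul_assoc, inv_mul_cancel₀ hx, mul_one, hr]
    · obtain ⟨r, hr⟩ := exists_forall_vecMul_eq_smul_of_subset_lineStabilizer hp hm hL hab hac hbc
        ha hb hc hT hTf ht
      refine mem_planeTorus_of_vecMul (r := r) ?_ ?_ ?_
      · rw [h0, hr u hu]
      · rw [h1, hr v hv]
      · obtain ⟨y, hy⟩ := hTw ht
        refine ⟨y, ?_⟩
        rw [h2, Matrix.smul_vecMul, hy, smul_comm]
  have hline : ∀ B : Matrix.SpecialLinearGroup (Fin 3) ℂ, B.1 0 = u → B.1 1 = v →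
      (∀ j, (p j).rep ∈ L ∨ ∃ r : ℂ, (p j).rep = r • B.1 2) →
      (inRows B planeTorus : Set _) ⊆ lineStabilizer (chowForm p m) := by
    intro B h0 h1 hB t ht
    obtain ⟨r, hr0, hr1, y, hy⟩ := exists_vecMul_of_mem_planeTorus ht
    refine mem_lineStabilizer_of_forall_mem_rowStabilizer p m fun j => ?_
    rcases hB j with hj | ⟨z, hz⟩
    · rw [← hspan, Submodule.mem_span_pair] at hj
      obtain ⟨x₀, x₁, hj⟩ := hj
      refine mem_rowStabilizer_of_eq_smul (c := r) ?_
      rw [← hj, ← h0, ← h1, Matrix.add_vecMul, Matrix.smul_vecMul, Matrix.smul_vecMul, hr0, hr1,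
        smul_add, smul_comm r, smul_comm r]
    · refine ⟨y, ?_⟩
      rw [hz, Matrix.smul_vecMul, hy, smul_comm]
  refine isRelativelyStable_iff_of_forall_lift (fun T H hT hH => ?_) ?_
  · obtain ⟨B, h0, h1, hB, hTB⟩ := hrows T hT.prop.1 hT.prop.2
    obtain rfl : T = inRows B planeTorus :=
      hT.eq_of_le ⟨isAlgebraicTorus_planeTorus.inRows B, hline B h0 h1 hB⟩ hTB
    obtain ⟨e, k, hd, he, hfe⟩ := hf B h0 h1 hB
    rw [isStable_iff_isStable_range_rowBlockHom hH, hfe, isStable_extendForm_iff B he]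
  · have hbot : ((⊥ : Subgroup (Matrix.SpecialLinearGroup (Fin 3) ℂ)) : Set _) ⊆
        lineStabilizer (chowForm p m) := by
      rintro _ rfl
      exact mem_lineStabilizer_of_forall_mem_rowStabilizer p m fun j => Subgroup.one_mem _
    obtain ⟨B, h0, h1, hB, -⟩ := hrows ⊥ isAlgebraicTorus_bot hbot
    refine ⟨inRows B planeTorus, _, ⟨⟨isAlgebraicTorus_planeTorus.inRows B, hline B h0 h1 hB⟩,
      fun T hT hle t ht => ?_⟩, isQuotientLift_range_rowBlockHom B⟩
    -- a larger torus centralizes this one, so it preserves the complement of the plane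
    obtain ⟨r, hr⟩ := exists_forall_vecMul_eq_smul_of_subset_lineStabilizer hp hm hL hab hac hbc
      ha hb hc hT.1 hT.2 ht
    refine mem_planeTorus_of_vecMul (r := r) (by rw [h0, hr u hu]) (by rw [h1, hr v hv])
      (mem_rowStabilizer_of_mem_centralizer_planeTorus ?_)
    exact Subgroup.mem_centralizer_iff.mpr fun x hx => hT.1.mul_comm (hle hx) ht

end Plane

/-! ### Independent points -/

section Independent

/-- The diagonal matrix of determinant one with first entries `t₀, t₁`. -/
noncomputable def diagMatrix (t : Fin 2 → ℂˣ) : Matrix.SpecialLinearGroup (Fin 3) ℂ :=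
  ⟨Matrix.diagonal ![(t 0 : ℂ), t 1, (t 0 : ℂ)⁻¹ * (t 1 : ℂ)⁻¹], by
    simp [Matrix.det_diagonal, Fin.prod_univ_three]
    field_simp⟩

theorem diagMatrix_coe (t : Fin 2 → ℂˣ) :
    (diagMatrix t).1 = Matrix.diagonal ![(t 0 : ℂ), t 1, (t 0 : ℂ)⁻¹ * (t 1 : ℂ)⁻¹] := rfl

/-- The parametrization of the diagonal matrices of determinant one. -/
noncomputable def diagTorusHom : (Fin 2 → ℂˣ) →* Matrix.SpecialLinearGroup (Fin 3) ℂ where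
  toFun := diagMatrix
  map_one' := by
    refine Matrix.SpecialLinearGroup.ext _ _ fun i j => ?_
    rw [diagMatrix_coe]
    fin_cases i <;> fin_cases j <;> simp
  map_mul' s t := by
    refine Matrix.SpecialLinearGroup.ext _ _ fun i j => ?_
    rw [Matrix.SpecialLinearGroup.coe_mul, diagMatrix_coe, diagMatrix_coe, diagMatrix_coe,
      Matrix.diagonal_mul_diagonal]
    fin_cases i <;> fin_cases j <;> simp
    ring

/-- The torus of diagonal matrices in `SL(3, ℂ)`. -/
noncomputable def diagTorus : Subgroup (Matrix.SpecialLinearGroup (Fin 3) ℂ) :=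
  diagTorusHom.range

theorem diagTorusHom_apply (t : Fin 2 → ℂˣ) : (diagTorusHom t).1 =
    Matrix.diagonal ![(t 0 : ℂ), t 1, (t 0 : ℂ)⁻¹ * (t 1 : ℂ)⁻¹] := rfl

theorem isAlgebraicTorus_diagTorus : IsAlgebraicTorus diagTorus := by
  refine ⟨2, diagTorusHom, fun s t h => ?_, fun i j => ?_, rfl⟩
  · have h0 := congrFun (congrFun (congrArg Subtype.val h) 0) 0
    have h1 := congrFun (congrFun (congrArg Subtype.val h) 1) 1
    funext i
    fin_cases i
    · exact Units.ext (by simpa [diagTorusHom_apply] using h0)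
    · exact Units.ext (by simpa [diagTorusHom_apply] using h1)
  · refine ⟨Matrix.diagonal ![MvPolynomial.X (Sum.inl 0), MvPolynomial.X (Sum.inl 1),
      MvPolynomial.X (Sum.inr 0) * MvPolynomial.X (Sum.inr 1)] i j, fun t => ?_⟩
    fin_cases i <;> fin_cases j <;> simp [diagTorusHom_apply]

theorem mem_diagTorus_iff {g : Matrix.SpecialLinearGroup (Fin 3) ℂ} :
    g ∈ diagTorus ↔ ∃ c, g.1 = Matrix.diagonal c := by
  constructor
  · rintro ⟨t, rfl⟩
    exact ⟨_, rfl⟩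
  · rintro ⟨c, hc⟩
    have hdet := g.2
    rw [hc, Matrix.det_diagonal, Fin.prod_univ_three] at hdet
    have h0 : c 0 ≠ 0 := fun h => by simp [h] at hdet
    have h1 : c 1 ≠ 0 := fun h => by simp [h] at hdet
    refine ⟨![Units.mk0 _ h0, Units.mk0 _ h1], Matrix.SpecialLinearGroup.ext _ _ fun i j => ?_⟩
    rw [hc, diagTorusHom_apply]
    have h2 : (c 0)⁻¹ * (c 1)⁻¹ = c 2 := by
      field_simp
      linear_combination -hdet
    fin_cases i <;> fin_cases j <;> simp [Matrix.diagonal, h2]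

theorem mem_inRows_diagTorus_iff {B g : Matrix.SpecialLinearGroup (Fin 3) ℂ} :
    g ∈ inRows B diagTorus ↔ ∀ i, g ∈ rowStabilizer (B.1 i) := by
  rw [mem_inRows, mem_diagTorus_iff]
  constructor
  · rintro ⟨c, hc⟩ i
    exact mem_rowStabilizer_of_eq_smul (vecMul_row_of_conj_val_eq_diagonal hc i)
  · intro h
    choose c hc using h
    exact ⟨fun i => c i, conj_val_eq_diagonal hc⟩

/-- The diagonal torus is its own centralizer. -/
theorem centralizer_diagTorus_le {B : Matrix.SpecialLinearGroup (Fin 3) ℂ} :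
    Subgroup.centralizer (inRows B diagTorus : Set _) ≤ inRows B diagTorus := by
  intro g hg
  let t := diagTorusHom ![Units.mk0 2 two_ne_zero, Units.mk0 3 three_ne_zero]
  have ht : B⁻¹ * t * B ∈ inRows B diagTorus := mem_inRows.mpr (by
    have ht : t ∈ diagTorus := ⟨_, rfl⟩
    rwa [show B * (B⁻¹ * t * B) * B⁻¹ = t by group])
  have h := congrArg (fun x => B * x * B⁻¹) (Subgroup.mem_centralizer_iff.mp hg _ ht)
  have hcomm : t * (B * g * B⁻¹) = (B * g * B⁻¹) * t := by simpa [mul_assoc] using h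
  rw [mem_inRows, mem_diagTorus_iff]
  generalize B * g * B⁻¹ = x at hcomm
  have ht' : t.1 = Matrix.diagonal ![(2 : ℂ), 3, 2⁻¹ * 3⁻¹] := rfl
  refine ⟨fun i => x.1 i i, ?_⟩
  ext i j
  rcases eq_or_ne i j with rfl | hij
  · simp
  · rw [Matrix.diagonal_apply_ne _ hij]
    have hentry : ![(2 : ℂ), 3, 2⁻¹ * 3⁻¹] i * x.1 i j = x.1 i j * ![(2 : ℂ), 3, 2⁻¹ * 3⁻¹] j := by
      have h := congrFun (congrFun (congrArg Subtype.val hcomm) i) j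
      rw [Matrix.SpecialLinearGroup.coe_mul, Matrix.SpecialLinearGroup.coe_mul, ht',
        Matrix.diagonal_mul, Matrix.mul_diagonal] at h
      exact h
    have hne : ![(2 : ℂ), 3, 2⁻¹ * 3⁻¹] i - ![(2 : ℂ), 3, 2⁻¹ * 3⁻¹] j ≠ 0 := by
      fin_cases i <;> fin_cases j <;> first | exact absurd rfl hij | norm_num
    exact (mul_eq_zero.mp (show _ * x.1 i j = 0 by linear_combination hentry)).resolve_left hne

/-- Under a finite group every nonzero form is stable. -/
theorem isStable_of_finite {n d : ℕ} {H : Subgroup (Matrix.SpecialLinearGroup (Fin n) ℂ)}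
    [Finite H] {f : Form n d} (hf : f ≠ 0) : GIT.IsStable H f := by
  refine ⟨⟨(Set.finite_range _).isClosed, ?_⟩, inferInstance⟩
  rw [GIT.mem_orbit_subgroup]
  rintro ⟨g, -, hg⟩
  exact hf (by rw [← inv_smul_smul g f, hg, Form.smul_zero'])

/-- Independent vectors in a spanning set `S` extend to a basis in `S`. -/
theorem exists_specialLinearGroup_rows_of_linearIndependent {ι : Type*} {r : ι → Fin 3 → ℂ}
    (hr : LinearIndependent ℂ r) {S : Set (Fin 3 → ℂ)} (hS : Submodule.span ℂ S = ⊤)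
    (hrS : ∀ j, r j ∈ S) :
    ∃ B : Matrix.SpecialLinearGroup (Fin 3) ℂ, (∀ i, ∃ v ∈ S, ∃ c : ℂ, B.1 i = c • v) ∧
      ∀ j, ∃ i, ∃ c : ℂ, r j = c • B.1 i := by
  obtain ⟨b, hbS, hrb, hSb, hb⟩ := exists_linearIndepOn_id_extension hr.linearIndepOn_id
    (Set.range_subset_iff.mpr hrS)
  have hspan : Submodule.span ℂ b = ⊤ := by
    rw [eq_top_iff, ← hS, Submodule.span_le]
    exact hSb
  let bas : Module.Basis b ℂ (Fin 3 → ℂ) := Module.Basis.mk hb (by simp [hspan])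
  have : Fintype b := FiniteDimensional.fintypeBasisIndex bas
  have hcard : Fintype.card b = Fintype.card (Fin 3) := by
    rw [← Module.finrank_eq_card_basis bas]
    simp
  let e : Fin 3 ≃ b := (Fintype.equivOfCardEq hcard).symm
  have hli : LinearIndependent ℂ ![(e 0 : Fin 3 → ℂ), e 1, e 2] := by
    have h := hb.linearIndependent.comp e e.injective
    have h' : (fun x : b => id (x : Fin 3 → ℂ)) ∘ e = ![(e 0 : Fin 3 → ℂ), e 1, e 2] := by
      ext1 i
      fin_cases i <;> rfl
    rwa [h'] at h
  obtain ⟨B, c, hc, h0, h1, h2⟩ := exists_specialLinearGroup_rows hli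
  have hrow : ∀ i, ∃ x : ℂ, x ≠ 0 ∧ B.1 i = x • (e i : Fin 3 → ℂ) := by
    intro i
    fin_cases i
    · exact ⟨1, one_ne_zero, by rw [one_smul]; exact h0⟩
    · exact ⟨1, one_ne_zero, by rw [one_smul]; exact h1⟩
    · exact ⟨c, hc, h2⟩
  refine ⟨B, fun i => ?_, fun j => ?_⟩
  · obtain ⟨x, -, hx⟩ := hrow i
    exact ⟨e i, hbS (e i).2, x, hx⟩
  · obtain ⟨i, hi⟩ := e.surjective ⟨r j, hrb ⟨j, rfl⟩⟩
    obtain ⟨x, hx0, hx⟩ := hrow i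
    refine ⟨i, x⁻¹, ?_⟩
    rw [hx, hi, inv_smul_smul₀ hx0]

variable {s : ℕ} {p : Fin s → ℙ ℂ (Fin 3 → ℂ)} {m : Fin s → ℕ}

/-- For independent points a maximal torus is a full diagonal torus, equal to its centralizer,
so lifts are finite. -/
theorem isRelativelyStable_of_linearIndependent (hp : Function.Injective p) (hm : ∀ j, 0 < m j)
    (hind : LinearIndependent ℂ fun j => (p j).rep) :
    (IsRelativelyStable (chowForm p m) ↔ True) ∧
      ∀ T H, IsMaximalTorusOfStabilizer (chowForm p m) T → IsQuotientLift T H →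
        (GIT.IsStable H (chowForm p m) ↔ IsRelativelyStable (chowForm p m)) := by
  have hrows : ∀ T : Subgroup (Matrix.SpecialLinearGroup (Fin 3) ℂ), IsAlgebraicTorus T →
      (T : Set _) ⊆ lineStabilizer (chowForm p m) →
      ∃ B : Matrix.SpecialLinearGroup (Fin 3) ℂ, T ≤ inRows B diagTorus ∧
        (inRows B diagTorus : Set _) ⊆ lineStabilizer (chowForm p m) := by
    intro T hT hTf
    obtain ⟨B, hBT, hB⟩ := exists_specialLinearGroup_rows_of_linearIndependent hind
      hT.span_rowEigenvectors ((hT.subset_lineStabilizer_chowForm_iff hp hm).mp hTf)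
    refine ⟨B, fun t ht => mem_inRows_diagTorus_iff.mpr fun i => ?_, fun t ht => ?_⟩
    · obtain ⟨v, hv, c, hc⟩ := hBT i
      obtain ⟨x, hx⟩ := hv ht
      exact ⟨x, by rw [hc, Matrix.smul_vecMul, hx, smul_comm]⟩
    · refine mem_lineStabilizer_of_forall_mem_rowStabilizer p m fun j => ?_
      obtain ⟨i, c, hc⟩ := hB j
      obtain ⟨x, hx⟩ := mem_inRows_diagTorus_iff.mp ht i
      exact ⟨x, by rw [hc, Matrix.smul_vecMul, hx, smul_comm]⟩
  refine isRelativelyStable_iff_of_forall_lift (fun T H hT hH => ?_) ?_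
  · obtain ⟨B, hTB, hB⟩ := hrows T hT.prop.1 hT.prop.2
    obtain rfl : T = inRows B diagTorus :=
      hT.eq_of_le ⟨isAlgebraicTorus_diagTorus.inRows B, hB⟩ hTB
    have hle : H ≤ inRows B diagTorus :=
      (hH.le_centralizer.trans connectedCentralizer_le_centralizer).trans centralizer_diagTorus_le
    have hfin := hH.finite_kernel
    rw [inf_eq_left.mpr hle] at hfin
    exact iff_true_intro (isStable_of_finite (chowForm_ne_zero p m))
  · have hbot : ((⊥ : Subgroup (Matrix.SpecialLinearGroup (Fin 3) ℂ)) : Set _) ⊆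
        lineStabilizer (chowForm p m) := by
      rintro _ rfl
      exact mem_lineStabilizer_of_forall_mem_rowStabilizer p m fun j => Subgroup.one_mem _
    obtain ⟨B, -, hB⟩ := hrows ⊥ isAlgebraicTorus_bot hbot
    refine ⟨inRows B diagTorus, ⊥, ⟨⟨isAlgebraicTorus_diagTorus.inRows B, hB⟩,
      fun T hT hle t ht => centralizer_diagTorus_le ?_⟩, ?_, bot_le, fun z hz => ?_, ?_⟩
    · exact Subgroup.mem_centralizer_iff.mpr fun x hx => hT.1.mul_comm (hle hx) ht
    · refine ⟨Set.range fun ij : Fin 3 × Fin 3 => MvPolynomial.X ij -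
        MvPolynomial.C ((1 : Matrix (Fin 3) (Fin 3) ℂ) ij.1 ij.2), fun g => ?_⟩
      rw [Subgroup.mem_bot, Set.forall_mem_range]
      simp only [map_sub, MvPolynomial.eval_X, MvPolynomial.eval_C, sub_eq_zero, Prod.forall]
      exact Matrix.SpecialLinearGroup.ext_iff _ _
    · exact ⟨1, Subgroup.one_mem _, z, centralizer_diagTorus_le
        (connectedCentralizer_le_centralizer hz), (one_mul z).symm⟩
    · rw [bot_inf_eq]
      infer_instance

end Independent

/-! ### Four points in general position -/

section FourPoints

/-- A linear map with four eigenlines in general position is a homothety. -/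
theorem exists_val_eq_smul_one {r : Fin 4 → Fin 3 → ℂ}
    (h012 : LinearIndependent ℂ ![r 0, r 1, r 2]) (h013 : LinearIndependent ℂ ![r 0, r 1, r 3])
    (h023 : LinearIndependent ℂ ![r 0, r 2, r 3]) (h123 : LinearIndependent ℂ ![r 1, r 2, r 3])
    {g : Matrix.SpecialLinearGroup (Fin 3) ℂ} (hg : ∀ i, g ∈ rowStabilizer (r i)) :
    ∃ c : ℂ, g.1 = c • (1 : Matrix (Fin 3) (Fin 3) ℂ) := by
  have hspan : Submodule.span ℂ (Set.range ![r 0, r 1, r 2]) = ⊤ :=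
    h012.span_eq_top_of_card_eq_finrank (by simp)
  have hr3 : r 3 ∈ Submodule.span ℂ (Set.range ![r 0, r 1, r 2]) := hspan ▸ Submodule.mem_top
  obtain ⟨x, hx⟩ := (Submodule.mem_span_range_iff_exists_fun ℂ).mp hr3
  simp only [Fin.sum_univ_three, Matrix.cons_val] at hx
  choose c hc using hg
  simp only [Units.smul_def] at hc
  -- each coordinate of the fourth vector is nonzero, so all eigenvalues agree
  have hx0 : x 0 ≠ 0 := fun h => by
    have h3 := Fintype.linearIndependent_iff.mp h123
      ![x 1, x 2, -1] (by simp [Fin.sum_univ_three, ← hx, h]; abel) 2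
    simp at h3
  have hx1 : x 1 ≠ 0 := fun h => by
    have h3 := Fintype.linearIndependent_iff.mp h023
      ![x 0, x 2, -1] (by simp [Fin.sum_univ_three, ← hx, h]; abel) 2
    simp at h3
  have hx2 : x 2 ≠ 0 := fun h => by
    have h3 := Fintype.linearIndependent_iff.mp h013
      ![x 0, x 1, -1] (by simp [Fin.sum_univ_three, ← hx, h]; abel) 2
    simp at h3
  have heq := hc 3
  rw [← hx, Matrix.add_vecMul, Matrix.add_vecMul, Matrix.smul_vecMul, Matrix.smul_vecMul,
    Matrix.smul_vecMul, hc, hc, hc] at heq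
  have hcoef := Fintype.linearIndependent_iff.mp h012
    ![x 0 * (c 0 - c 3), x 1 * (c 1 - c 3), x 2 * (c 2 - c 3)] (by
      simp only [Fin.sum_univ_three, Matrix.cons_val, mul_sub, sub_smul, mul_smul]
      simp only [smul_add] at heq
      rw [smul_comm (x 0) (c 3 : ℂ), smul_comm (x 1) (c 3 : ℂ), smul_comm (x 2) (c 3 : ℂ)]
      linear_combination (exp := 1) heq)
  have e0 : (c 0 : ℂ) = c 3 :=
    sub_eq_zero.mp ((mul_eq_zero.mp (by simpa using hcoef 0)).resolve_left hx0)
  have e1 : (c 1 : ℂ) = c 3 :=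
    sub_eq_zero.mp ((mul_eq_zero.mp (by simpa using hcoef 1)).resolve_left hx1)
  have e2 : (c 2 : ℂ) = c 3 :=
    sub_eq_zero.mp ((mul_eq_zero.mp (by simpa using hcoef 2)).resolve_left hx2)
  refine ⟨c 3, ?_⟩
  have hmap : g.1.vecMulLinear = (c 3 : ℂ) • LinearMap.id := by
    refine LinearMap.ext_on_range hspan fun i => ?_
    fin_cases i
    · simpa [e0] using hc 0
    · simpa [e1] using hc 1
    · simpa [e2] using hc 2
  ext i j
  have := congrFun (LinearMap.congr_fun hmap (Pi.single i 1)) j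
  simpa [Matrix.one_apply, Pi.single_apply, eq_comm] using this

variable {s : ℕ} {p : Fin s → ℙ ℂ (Fin 3 → ℂ)} {m : Fin s → ℕ}

/-- With four points in general position the trivial torus is maximal, and its only lift is the
whole group. -/
theorem isRelativelyStable_iff_of_four_points (hp : Function.Injective p) (hm : ∀ j, 0 < m j)
    (a : Fin 4 → Fin s)
    (h012 : LinearIndependent ℂ ![(p (a 0)).rep, (p (a 1)).rep, (p (a 2)).rep])
    (h013 : LinearIndependent ℂ ![(p (a 0)).rep, (p (a 1)).rep, (p (a 3)).rep])
    (h023 : LinearIndependent ℂ ![(p (a 0)).rep, (p (a 2)).rep, (p (a 3)).rep])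
    (h123 : LinearIndependent ℂ ![(p (a 1)).rep, (p (a 2)).rep, (p (a 3)).rep]) :
    (IsRelativelyStable (chowForm p m) ↔ IsChowStable p m) ∧
      ∀ T H, IsMaximalTorusOfStabilizer (chowForm p m) T → IsQuotientLift T H →
        (GIT.IsStable H (chowForm p m) ↔ IsRelativelyStable (chowForm p m)) := by
  have htriv : ∀ T : Subgroup (Matrix.SpecialLinearGroup (Fin 3) ℂ), IsAlgebraicTorus T →
      (T : Set _) ⊆ lineStabilizer (chowForm p m) → T = ⊥ := by
    intro T hT hTf
    rw [eq_bot_iff]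
    intro g hg
    -- a cube root in the torus is a homothety of determinant one, so its cube is trivial
    obtain ⟨h, hh, rfl⟩ := hT.exists_pow_eq hg (k := 3) (by decide)
    obtain ⟨c, hc⟩ := exists_val_eq_smul_one (r := fun i => (p (a i)).rep)
      h012 h013 h023 h123 fun i =>
      (hT.subset_lineStabilizer_chowForm_iff hp hm).mp hTf (a i) hh
    have hdet := h.2
    rw [hc, Matrix.det_smul, Matrix.det_one, mul_one, Fintype.card_fin] at hdet
    rw [Subgroup.mem_bot]
    refine Matrix.SpecialLinearGroup.ext _ _ fun i j => ?_
    rw [Matrix.SpecialLinearGroup.coe_pow, hc, smul_pow, hdet, one_smul, one_pow]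
    rfl
  have hcent : connectedCentralizer (⊥ : Subgroup (Matrix.SpecialLinearGroup (Fin 3) ℂ)) = ⊤ := by
    have hid : (MonoidHom.id (Matrix.SpecialLinearGroup (Fin 3) ℂ)).range = ⊤ :=
      MonoidHom.range_eq_top.mpr Function.surjective_id
    rw [eq_top_iff, ← hid]
    refine range_le_connectedCentralizer continuous_id fun g _ => ?_
    rw [Subgroup.mem_centralizer_iff]
    rintro _ rfl
    simp
  refine isRelativelyStable_iff_of_forall_lift (fun T H hT hH => ?_) ?_
  · obtain rfl := htriv T hT.prop.1 hT.prop.2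
    have hH' : H = ⊤ := by
      rw [eq_top_iff]
      intro z _
      obtain ⟨h, hh, t, rfl, rfl⟩ := hH.surjective z (hcent ▸ Subgroup.mem_top z)
      simpa using hh
    rw [hH']
    rfl
  · have hbot : ((⊥ : Subgroup (Matrix.SpecialLinearGroup (Fin 3) ℂ)) : Set _) ⊆
        lineStabilizer (chowForm p m) := by
      rintro _ rfl
      exact mem_lineStabilizer_of_forall_mem_rowStabilizer p m fun j => Subgroup.one_mem _
    refine ⟨⊥, ⊤, ⟨⟨isAlgebraicTorus_bot, hbot⟩, fun T hT _ => (htriv T hT.1 hT.2).le⟩, ?_, ?_,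
      fun z _ => ⟨z, Subgroup.mem_top z, 1, Subgroup.one_mem _, (mul_one z).symm⟩, ?_⟩
    · exact ⟨∅, by simp⟩
    · rw [hcent]
    · rw [top_inf_eq]
      infer_instance

end FourPoints

/-! ### Positions of points in the projective plane -/

section Positions

theorem linearIndependent_rotate {u v w : Fin 3 → ℂ} (h : LinearIndependent ℂ ![u, v, w]) :
    LinearIndependent ℂ ![w, u, v] := by
  have h' := h.comp ![2, 0, 1] (by decide)
  have he : ![u, v, w] ∘ ![2, 0, 1] = ![w, u, v] := by
    ext1 i
    fin_cases i <;> rfl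
  rwa [he] at h'

theorem linearIndependent_swap {u v w : Fin 3 → ℂ} (h : LinearIndependent ℂ ![u, v, w]) :
    LinearIndependent ℂ ![v, u, w] := by
  have h' := h.comp ![1, 0, 2] (by decide)
  have he : ![u, v, w] ∘ ![1, 0, 2] = ![v, u, w] := by
    ext1 i
    fin_cases i <;> rfl
  rwa [he] at h'

theorem linearIndependent_rep_of_not_isCollinear {a b c : ℙ ℂ (Fin 3 → ℂ)}
    (h : ¬ Projectivization.IsCollinear {a, b, c}) : LinearIndependent ℂ ![a.rep, b.rep, c.rep] := by
  by_contra hdep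
  apply h
  let S := Submodule.span ℂ (Set.range ![a.rep, b.rep, c.rep])
  have hmem : ∀ i, ![a.rep, b.rep, c.rep] i ∈ S := fun i => Submodule.subset_span ⟨i, rfl⟩
  refine ⟨S.projectivization, ?_, ?_, ?_⟩
  · rw [Projectivization.Subspace.submodule.apply_symm_apply]
    infer_instance
  · rw [Projectivization.Subspace.submodule.apply_symm_apply]
    have hle : Module.finrank ℂ S ≤ 3 := finrank_range_le_card (R := ℂ) ![a.rep, b.rep, c.rep]
    have hne : 3 ≠ Module.finrank ℂ S := fun h3 =>
      hdep (linearIndependent_iff_card_eq_finrank_span.mpr (by rw [Fintype.card_fin]; exact h3))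
    omega
  · have hS : ∀ x : ℙ ℂ (Fin 3 → ℂ), x.rep ∈ S → x ∈ (S.projectivization : Set _) := by
      intro x hx
      rw [SetLike.mem_coe, Submodule.mem_projectivization_iff_submodule_le,
        Projectivization.submodule_eq, Submodule.span_singleton_le_iff_mem]
      exact hx
    rintro x (rfl | rfl | rfl)
    exacts [hS _ (hmem 0), hS _ (hmem 1), hS _ (hmem 2)]

variable {L : Submodule ℂ (Fin 3 → ℂ)} {s : ℕ} {p : Fin s → ℙ ℂ (Fin 3 → ℂ)}

theorem finrank_span_rep_pair {a b : ℙ ℂ (Fin 3 → ℂ)} (h : a ≠ b) :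
    Module.finrank ℂ (Submodule.span ℂ {a.rep, b.rep}) = 2 := by
  have := finrank_span_eq_card (linearIndependent_rep_pair h)
  rwa [Matrix.range_cons, Matrix.range_cons, Matrix.range_empty, Set.union_empty,
    Set.singleton_union, Fintype.card_fin] at this

theorem span_rep_pair_eq (hL : Module.finrank ℂ L = 2) {a b : ℙ ℂ (Fin 3 → ℂ)} (h : a ≠ b)
    (ha : a.rep ∈ L) (hb : b.rep ∈ L) : Submodule.span ℂ {a.rep, b.rep} = L := by
  refine Submodule.eq_of_le_of_finrank_eq ?_ ((finrank_span_rep_pair h).trans hL.symm)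
  rw [Submodule.span_le]
  rintro x (rfl | rfl)
  exacts [ha, hb]

theorem linearIndependent_rep_of_notMem {a b : ℙ ℂ (Fin 3 → ℂ)} (h : a ≠ b) {w : Fin 3 → ℂ}
    (hw : w ∉ Submodule.span ℂ {a.rep, b.rep}) : LinearIndependent ℂ ![a.rep, b.rep, w] :=
  linearIndependent_of_notMem (finrank_span_rep_pair h) rfl hw

theorem linearIndependent_rep_of_le_two (hp : Function.Injective p) (hs : s ≤ 2) :
    LinearIndependent ℂ fun j => (p j).rep := by
  interval_cases s
  · exact linearIndependent_empty_type
  · exact linearIndependent_unique_iff.mpr (p default).rep_nonzero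
  · have h := linearIndependent_rep_pair (hp.ne (show (0 : Fin 2) ≠ 1 by decide))
    have he : (fun j => (p j).rep) = ![(p 0).rep, (p 1).rep] := by
      ext1 i
      fin_cases i <;> rfl
    rwa [he]

/-- Of three points on a line, a second line through a point off the first misses two. -/
theorem exists_four_points_of_notMem (hp : Function.Injective p) (hL : Module.finrank ℂ L = 2)
    {a b d c e : Fin s} (hab : a ≠ b) (had : a ≠ d) (hbd : b ≠ d) (ha : (p a).rep ∈ L)
    (hb : (p b).rep ∈ L) (hd : (p d).rep ∈ L) (hce : c ≠ e) (hc : (p c).rep ∉ L)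
    (he : (p e).rep ∉ L) :
    ∃ t : Fin 4 → Fin s, LinearIndependent ℂ ![(p (t 0)).rep, (p (t 1)).rep, (p (t 2)).rep] ∧
      LinearIndependent ℂ ![(p (t 0)).rep, (p (t 1)).rep, (p (t 3)).rep] ∧
      LinearIndependent ℂ ![(p (t 0)).rep, (p (t 2)).rep, (p (t 3)).rep] ∧
      LinearIndependent ℂ ![(p (t 1)).rep, (p (t 2)).rep, (p (t 3)).rep] := by
  let M := Submodule.span ℂ {(p c).rep, (p e).rep}
  have hM : Module.finrank ℂ M = 2 := finrank_span_rep_pair (hp.ne hce)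
  have hcM : (p c).rep ∈ M := Submodule.subset_span (by simp)
  have key : ∀ x y : Fin s, x ≠ y → (p x).rep ∈ L → (p y).rep ∈ L → (p x).rep ∉ M →
      (p y).rep ∉ M → ∃ t : Fin 4 → Fin s,
        LinearIndependent ℂ ![(p (t 0)).rep, (p (t 1)).rep, (p (t 2)).rep] ∧
        LinearIndependent ℂ ![(p (t 0)).rep, (p (t 1)).rep, (p (t 3)).rep] ∧
        LinearIndependent ℂ ![(p (t 0)).rep, (p (t 2)).rep, (p (t 3)).rep] ∧
        LinearIndependent ℂ ![(p (t 1)).rep, (p (t 2)).rep, (p (t 3)).rep] := by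
    intro x y hxy hx hy hxM hyM
    have hspan := span_rep_pair_eq hL (hp.ne hxy) hx hy
    exact ⟨![x, y, c, e], linearIndependent_rep_of_notMem (hp.ne hxy) (hspan ▸ hc),
      linearIndependent_rep_of_notMem (hp.ne hxy) (hspan ▸ he),
      linearIndependent_rotate (linearIndependent_rep_of_notMem (hp.ne hce) hxM),
      linearIndependent_rotate (linearIndependent_rep_of_notMem (hp.ne hce) hyM)⟩
  have hone : ∀ x y : Fin s, x ≠ y → (p x).rep ∈ L → (p y).rep ∈ L → (p x).rep ∈ M →
      (p y).rep ∉ M := by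
    intro x y hxy hx hy hxM hyM
    apply hc
    rw [← span_rep_pair_eq hL (hp.ne hxy) hx hy, span_rep_pair_eq hM (hp.ne hxy) hxM hyM]
    exact hcM
  by_cases haM : (p a).rep ∈ M
  · exact key b d hbd hb hd (hone a b hab ha hb haM) (hone a d had ha hd haM)
  · by_cases hbM : (p b).rep ∈ M
    · exact key a d had ha hd haM (hone b d hbd hb hd hbM)
    · exact key a b hab ha hb haM hbM

/-- Distinct points in the plane are independent, or four of them are in general position, or
at least three are on a line with at most one point off it. -/
theorem position_trichotomy (hp : Function.Injective p) :
    (LinearIndependent ℂ fun j => (p j).rep) ∨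
    (∃ t : Fin 4 → Fin s, LinearIndependent ℂ ![(p (t 0)).rep, (p (t 1)).rep, (p (t 2)).rep] ∧
      LinearIndependent ℂ ![(p (t 0)).rep, (p (t 1)).rep, (p (t 3)).rep] ∧
      LinearIndependent ℂ ![(p (t 0)).rep, (p (t 2)).rep, (p (t 3)).rep] ∧
      LinearIndependent ℂ ![(p (t 1)).rep, (p (t 2)).rep, (p (t 3)).rep]) ∨
    ∃ L : Submodule ℂ (Fin 3 → ℂ), Module.finrank ℂ L = 2 ∧ 3 ≤ s ∧
      ((∀ j, (p j).rep ∈ L) ∨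
        4 ≤ s ∧ ∃ j₀, (p j₀).rep ∉ L ∧ ∀ j, j ≠ j₀ → (p j).rep ∈ L) := by
  rcases le_or_gt s 2 with hs | hs
  · exact Or.inl (linearIndependent_rep_of_le_two hp hs)
  refine or_iff_not_imp_left.mpr fun hdep => or_iff_not_imp_left.mpr fun hgen => ?_
  let i : Fin s := ⟨0, by omega⟩
  let j : Fin s := ⟨1, by omega⟩
  have hij : i ≠ j := by simp [i, j]
  by_cases hall : ∀ k, (p k).rep ∈ Submodule.span ℂ {(p i).rep, (p j).rep}
  · exact ⟨_, finrank_span_rep_pair (hp.ne hij), hs, Or.inl hall⟩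
  push Not at hall
  obtain ⟨k, hk⟩ := hall
  have hijk := linearIndependent_rep_of_notMem (hp.ne hij) hk
  have hki : k ≠ i := by
    rintro rfl
    exact hk (Submodule.subset_span (by simp))
  have hkj : k ≠ j := by
    rintro rfl
    exact hk (Submodule.subset_span (by simp))
  have hs4 : 4 ≤ s := by
    by_contra hlt
    apply hdep
    refine linearIndependent_of_top_le_span_of_card_eq_finrank ?_ (by simp; omega)
    rw [← hijk.span_eq_top_of_card_eq_finrank (by simp)]
    refine Submodule.span_mono ?_
    rintro _ ⟨l, rfl⟩
    fin_cases l
    exacts [⟨i, rfl⟩, ⟨j, rfl⟩, ⟨k, rfl⟩]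
  obtain ⟨l, hl⟩ : ∃ l : Fin s, l ∉ ({i, j, k} : Finset (Fin s)) := by
    by_contra hnot
    push Not at hnot
    have h1 := Finset.card_le_card (fun x _ => hnot x : Finset.univ ⊆ ({i, j, k} : Finset (Fin s)))
    have h2 : ({i, j, k} : Finset (Fin s)).card ≤ 3 := Finset.card_le_three
    rw [Finset.card_univ, Fintype.card_fin] at h1
    omega
  simp only [Finset.mem_insert, Finset.mem_singleton, not_or] at hl
  obtain ⟨hli, hlj, hlk⟩ := hl
  -- a fourth point is on one of the three lines, and then all others are on the same line
  have hline : ∀ a b c : Fin s, a ≠ b → l ≠ a → l ≠ b →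
      LinearIndependent ℂ ![(p a).rep, (p b).rep, (p c).rep] →
      (p l).rep ∈ Submodule.span ℂ {(p a).rep, (p b).rep} →
      ∃ L : Submodule ℂ (Fin 3 → ℂ), Module.finrank ℂ L = 2 ∧ 3 ≤ s ∧
        ((∀ j, (p j).rep ∈ L) ∨
          4 ≤ s ∧ ∃ j₀, (p j₀).rep ∉ L ∧ ∀ j, j ≠ j₀ → (p j).rep ∈ L) := by
    intro a b c hab hla hlb hind hl
    have hL := finrank_span_rep_pair (hp.ne hab)
    have hc : (p c).rep ∉ Submodule.span ℂ {(p a).rep, (p b).rep} := by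
      have h := (linearIndependent_finSucc'.mp hind).2
      have hinit : Fin.init ![(p a).rep, (p b).rep, (p c).rep] = ![(p a).rep, (p b).rep] := by
        ext1 i
        fin_cases i <;> rfl
      rwa [hinit, Matrix.range_cons, Matrix.range_cons, Matrix.range_empty, Set.union_empty,
        Set.singleton_union] at h
    refine ⟨_, hL, hs, Or.inr ⟨hs4, c, hc, fun e hec => ?_⟩⟩
    by_contra he
    exact hgen (exists_four_points_of_notMem hp hL hab hla.symm hlb.symm
      (Submodule.subset_span (by simp)) (Submodule.subset_span (by simp)) hl hec.symm hc he)
  by_cases h1 : (p l).rep ∈ Submodule.span ℂ {(p i).rep, (p j).rep}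
  · exact hline i j k hij hli hlj hijk h1
  by_cases h2 : (p l).rep ∈ Submodule.span ℂ {(p k).rep, (p i).rep}
  · exact hline k i j hki hlk hli (linearIndependent_rotate hijk) h2
  by_cases h3 : (p l).rep ∈ Submodule.span ℂ {(p j).rep, (p k).rep}
  · exact hline j k i hkj.symm hlj hlk (linearIndependent_rotate (linearIndependent_rotate hijk)) h3
  exact absurd ⟨![k, i, j, l], linearIndependent_rotate hijk,
    linearIndependent_rep_of_notMem (hp.ne hki) h2, linearIndependent_swap
      (linearIndependent_rep_of_notMem (hp.ne hkj.symm) h3),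
    linearIndependent_rep_of_notMem (hp.ne hij) h1⟩ hgen

end Positions

/-! ### Chow forms of points on a line -/

section Line

variable {L : Submodule ℂ (Fin 3 → ℂ)} {ι : Type*}

theorem linearEquiv_apply_eq (e : (Fin 2 → ℂ) ≃ₗ[ℂ] L) (x : Fin 2 → ℂ) :
    (e x : Fin 3 → ℂ) = x 0 • (e (Pi.single 0 1) : Fin 3 → ℂ) +
      x 1 • (e (Pi.single 1 1) : Fin 3 → ℂ) := by
  have hx : x = x 0 • Pi.single 0 1 + x 1 • Pi.single 1 1 := by
    ext i
    fin_cases i <;> simp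
  conv_lhs => rw [hx]
  simp only [map_add, map_smul, Submodule.coe_add, Submodule.coe_smul]

theorem span_linearEquiv_single (e : (Fin 2 → ℂ) ≃ₗ[ℂ] L) :
    Submodule.span ℂ {(e (Pi.single 0 1) : Fin 3 → ℂ), (e (Pi.single 1 1) : Fin 3 → ℂ)} = L := by
  refine le_antisymm ?_ fun x hx => ?_
  · rw [Submodule.span_le]
    rintro x (rfl | rfl)
    exacts [Subtype.property _, Subtype.property _]
  · rw [Submodule.mem_span_pair]
    have h := linearEquiv_apply_eq e (e.symm ⟨x, hx⟩)
    rw [e.apply_symm_apply] at h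
    exact ⟨_, _, h.symm⟩

theorem exists_rep_eq_smul (e : (Fin 2 → ℂ) ≃ₗ[ℂ] L) {P : ℙ ℂ (Fin 3 → ℂ)} {Q : ℙ ℂ (Fin 2 → ℂ)}
    (h : Projectivization.map (L.subtype.comp e.toLinearMap)
      (L.injective_subtype.comp e.injective) Q = P) :
    ∃ c : ℂˣ, P.rep = c • (e Q.rep : Fin 3 → ℂ) := by
  rw [← Q.mk_rep, Projectivization.map_mk, ← P.mk_rep, eq_comm,
    Projectivization.mk_eq_mk_iff] at h
  obtain ⟨c, hc⟩ := h
  refine ⟨c, ?_⟩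
  rw [← P.mk_rep]
  simpa [Projectivization.mk_rep] using hc.symm

theorem exists_rep_dotProduct_eq (e : (Fin 2 → ℂ) ≃ₗ[ℂ] L) {P : ℙ ℂ (Fin 3 → ℂ)}
    {Q : ℙ ℂ (Fin 2 → ℂ)} (h : Projectivization.map (L.subtype.comp e.toLinearMap)
      (L.injective_subtype.comp e.injective) Q = P) :
    ∃ c : ℂ, c ≠ 0 ∧ ∀ x, P.rep ⬝ᵥ x =
      c * (Q.rep ⬝ᵥ ![(e (Pi.single 0 1) : Fin 3 → ℂ) ⬝ᵥ x,
        (e (Pi.single 1 1) : Fin 3 → ℂ) ⬝ᵥ x]) := by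
  obtain ⟨c, hc⟩ := exists_rep_eq_smul e h
  refine ⟨c, c.ne_zero, fun x => ?_⟩
  rw [hc, linearEquiv_apply_eq e, Units.smul_def, smul_dotProduct, add_dotProduct,
    smul_dotProduct, smul_dotProduct]
  simp [dotProduct, Fin.sum_univ_two]

/-- Points of a line have coordinates on it. -/
theorem exists_map_eq (e : (Fin 2 → ℂ) ≃ₗ[ℂ] L) {p : ι → ℙ ℂ (Fin 3 → ℂ)}
    (hp : ∀ j, (p j).rep ∈ L) : ∃ q : ι → ℙ ℂ (Fin 2 → ℂ), ∀ j,
      Projectivization.map (L.subtype.comp e.toLinearMap)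
        (L.injective_subtype.comp e.injective) (q j) = p j := by
  refine ⟨fun j => Projectivization.mk ℂ (e.symm ⟨(p j).rep, hp j⟩) ?_, fun j => ?_⟩
  · rw [ne_eq, LinearEquiv.map_eq_zero_iff]
    exact fun h => (p j).rep_nonzero (congrArg Subtype.val h)
  · rw [Projectivization.map_mk]
    conv_rhs => rw [← (p j).mk_rep]
    congr 1
    simp

/-- If stability of `f` is equivalent to Chow stability for all coordinates on the line, it is
equivalent to Chow stability on the line. -/
theorem iff_isChowStableOnLine [Fintype ι] (hL : Module.finrank ℂ L = 2)
    {p : ι → ℙ ℂ (Fin 3 → ℂ)} {m : ι → ℕ} (hp : ∀ j, (p j).rep ∈ L) {P : Prop}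
    (h : ∀ (e : (Fin 2 → ℂ) ≃ₗ[ℂ] L) (q : ι → ℙ ℂ (Fin 2 → ℂ)),
      (∀ j, Projectivization.map (L.subtype.comp e.toLinearMap)
        (L.injective_subtype.comp e.injective) (q j) = p j) → (P ↔ IsChowStable q m)) :
    P ↔ IsChowStableOnLine L p m := by
  constructor
  · intro hP
    let e : (Fin 2 → ℂ) ≃ₗ[ℂ] L := LinearEquiv.ofFinrankEq _ _ (by rw [hL]; simp)
    obtain ⟨q, hq⟩ := exists_map_eq e hp
    exact ⟨e, q, hq, (h e q hq).mp hP⟩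
  · rintro ⟨e, q, hq, hs⟩
    exact (h e q hq).mpr hs

theorem exists_notMem_rowEigenvector (hL : Module.finrank ℂ L = 2)
    {T : Subgroup (Matrix.SpecialLinearGroup (Fin 3) ℂ)} (hT : IsAlgebraicTorus T) :
    ∃ w, w ∉ L ∧ T ≤ rowStabilizer w := by
  by_contra hnot
  push Not at hnot
  have hle : Submodule.span ℂ {v : Fin 3 → ℂ | T ≤ rowStabilizer v} ≤ L := by
    rw [Submodule.span_le]
    intro v hv
    by_contra hvL
    exact hnot v hvL hv
  rw [hT.span_rowEigenvectors, top_le_iff] at hle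
  rw [hle, finrank_top] at hL
  simp at hL

variable {s : ℕ} {p : Fin s → ℙ ℂ (Fin 3 → ℂ)} {m : Fin s → ℕ}

theorem isRelativelyStable_iff_of_collinear (hp : Function.Injective p) (hm : ∀ j, 0 < m j)
    (hL : Module.finrank ℂ L = 2) (hs : 3 ≤ s) (hpL : ∀ j, (p j).rep ∈ L)
    (e : (Fin 2 → ℂ) ≃ₗ[ℂ] L) {q : Fin s → ℙ ℂ (Fin 2 → ℂ)}
    (hq : ∀ j, Projectivization.map (L.subtype.comp e.toLinearMap)
      (L.injective_subtype.comp e.injective) (q j) = p j) :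
    (IsRelativelyStable (chowForm p m) ↔ IsChowStable q m) ∧
      ∀ T H, IsMaximalTorusOfStabilizer (chowForm p m) T → IsQuotientLift T H →
        (GIT.IsStable H (chowForm p m) ↔ IsRelativelyStable (chowForm p m)) := by
  choose c hc0 hc using fun j => exists_rep_dotProduct_eq e (hq j)
  refine isRelativelyStable_iff_of_plane hp hm hL (a := ⟨0, by omega⟩) (b := ⟨1, by omega⟩)
    (c := ⟨2, by omega⟩) (by simp) (by simp) (by simp) (hpL _) (hpL _) (hpL _)
    (span_linearEquiv_single e) (chowForm q m) (fun T hT _ => ?_) fun B h0 h1 _ => ?_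
  · obtain ⟨w, hwL, hw⟩ := exists_notMem_rowEigenvector hL hT
    exact ⟨w, hwL, hw, fun j => Or.inl (hpL j)⟩
  · refine ⟨∏ j, c j ^ m j, 0, zero_add _,
      Finset.prod_ne_zero_iff.mpr fun j _ => pow_ne_zero _ (hc0 j), Form.ext_eval fun x => ?_⟩
    rw [eval_extendForm, eval_chowForm, eval_chowForm, pow_zero, mul_one,
      ← Finset.prod_mul_distrib, h0, h1]
    exact Finset.prod_congr rfl fun j _ => by rw [hc, mul_pow]

theorem isRelativelyStable_iff_of_collinear_compl (hp : Function.Injective p) (hm : ∀ j, 0 < m j)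
    (hL : Module.finrank ℂ L = 2) (hs : 4 ≤ s) {j₀ : Fin s} (hj₀ : (p j₀).rep ∉ L)
    (hpL : ∀ j, j ≠ j₀ → (p j).rep ∈ L) (e : (Fin 2 → ℂ) ≃ₗ[ℂ] L)
    {q : {j : Fin s // j ≠ j₀} → ℙ ℂ (Fin 2 → ℂ)}
    (hq : ∀ j : {j : Fin s // j ≠ j₀}, Projectivization.map (L.subtype.comp e.toLinearMap)
      (L.injective_subtype.comp e.injective) (q j) = p j) :
    (IsRelativelyStable (chowForm p m) ↔ IsChowStable q fun j : {j : Fin s // j ≠ j₀} => m j) ∧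
      ∀ T H, IsMaximalTorusOfStabilizer (chowForm p m) T → IsQuotientLift T H →
        (GIT.IsStable H (chowForm p m) ↔ IsRelativelyStable (chowForm p m)) := by
  choose c hc0 hc using fun j => exists_rep_dotProduct_eq e (hq j)
  obtain ⟨a, b, d, hab, had, hbd, ha, hb, hd⟩ : ∃ a b d : Fin s, a ≠ b ∧ a ≠ d ∧ b ≠ d ∧
      a ≠ j₀ ∧ b ≠ j₀ ∧ d ≠ j₀ := by
    have hcard : 2 < (Finset.univ.erase j₀).card := by
      rw [Finset.card_erase_of_mem (Finset.mem_univ _), Finset.card_univ, Fintype.card_fin]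
      omega
    obtain ⟨a, b, d, ha, hb, hd, hab, had, hbd⟩ := Finset.two_lt_card_iff.mp hcard
    exact ⟨a, b, d, hab, had, hbd, Finset.ne_of_mem_erase ha, Finset.ne_of_mem_erase hb,
      Finset.ne_of_mem_erase hd⟩
  refine isRelativelyStable_iff_of_plane hp hm hL hab had hbd (hpL _ ha) (hpL _ hb) (hpL _ hd)
    (span_linearEquiv_single e) (chowForm q fun j : {j : Fin s // j ≠ j₀} => m j)
    (fun T hT hTf => ?_) fun B h0 h1 hB => ?_
  · refine ⟨(p j₀).rep, hj₀, (hT.subset_lineStabilizer_chowForm_iff hp hm).mp hTf j₀, fun j => ?_⟩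
    rcases eq_or_ne j j₀ with rfl | hj
    · exact Or.inr ⟨1, (one_smul _ _).symm⟩
    · exact Or.inl (hpL j hj)
  · obtain ⟨r, hr⟩ := (hB j₀).resolve_left hj₀
    have hr0 : r ≠ 0 := by
      rintro rfl
      exact (p j₀).rep_nonzero (by rw [hr, zero_smul])
    refine ⟨r ^ m j₀ * ∏ j, c j ^ m j, m j₀, (Fintype.sum_eq_add_sum_subtype_ne m j₀).symm,
      mul_ne_zero (pow_ne_zero _ hr0) (Finset.prod_ne_zero_iff.mpr fun j _ => pow_ne_zero _ (hc0 j)),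
      Form.ext_eval fun x => ?_⟩
    have hprod : ∏ j : {j : Fin s // j ≠ j₀}, ((p j).rep ⬝ᵥ x) ^ m j =
        (∏ j, c j ^ m j) * ∏ j : {j : Fin s // j ≠ j₀}, ((q j).rep ⬝ᵥ
          ![B.1 0 ⬝ᵥ x, B.1 1 ⬝ᵥ x]) ^ m j := by
      rw [← Finset.prod_mul_distrib, h0, h1]
      exact Finset.prod_congr rfl fun j _ => by rw [hc, mul_pow]
    rw [eval_extendForm, eval_chowForm, eval_chowForm,
      Fintype.prod_eq_mul_prod_subtype_ne (fun j => ((p j).rep ⬝ᵥ x) ^ m j) j₀, hprod, hr,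
      smul_dotProduct, smul_eq_mul, mul_pow]
    ring

end Line

theorem mainTheorem5 (s : ℕ) (p : Fin s → ℙ ℂ (Fin 3 → ℂ)) (hp : Function.Injective p)
    (m : Fin s → ℕ) (hm : ∀ j, 0 < m j) :
    -- relative stability does not depend on the choices made in its definition
    (∀ T H : Subgroup (Matrix.SpecialLinearGroup (Fin 3) ℂ),
      IsMaximalTorusOfStabilizer (chowForm p m) T → IsQuotientLift T H →
        (GIT.IsStable H (chowForm p m) ↔ IsRelativelyChowStable p m)) ∧
    -- (i) at most two points, or three non-aligned points
    ((s ≤ 2 ∨ (s = 3 ∧ ¬ Projectivization.IsCollinear (Set.range p))) →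
      IsRelativelyChowStable p m) ∧
    -- (ii) at least three points, all on a line
    (∀ L : Submodule ℂ (Fin 3 → ℂ), Module.finrank ℂ L = 2 → 3 ≤ s →
      (∀ j, (p j).submodule ≤ L) →
        (IsRelativelyChowStable p m ↔ IsChowStableOnLine L p m)) ∧
    -- (iii) at least four points, all of them but one on a line
    (∀ (L : Submodule ℂ (Fin 3 → ℂ)) (j₀ : Fin s), Module.finrank ℂ L = 2 → 4 ≤ s →
      ¬ (p j₀).submodule ≤ L → (∀ j, j ≠ j₀ → (p j).submodule ≤ L) →
        (IsRelativelyChowStable p m ↔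
          IsChowStableOnLine L (fun j : {j : Fin s // j ≠ j₀} => p j)
            (fun j : {j : Fin s // j ≠ j₀} => m j))) ∧
    -- (iv) four of the points are three by three non-aligned
    ((∃ a : Fin 4 ↪ Fin s, ∀ i j k : Fin 4, i ≠ j → j ≠ k → i ≠ k →
        ¬ Projectivization.IsCollinear {p (a i), p (a j), p (a k)}) →
      (IsRelativelyChowStable p m ↔ IsChowStable p m)) := by
  have hmem : ∀ (L : Submodule ℂ (Fin 3 → ℂ)) (x : ℙ ℂ (Fin 3 → ℂ)),
      x.submodule ≤ L ↔ x.rep ∈ L := fun L x => by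
    rw [Projectivization.submodule_eq, Submodule.span_singleton_le_iff_mem]
  refine ⟨?_, fun h => ?_, fun L hL hs hpL => ?_, fun L j₀ hL hs hj₀ hpL => ?_, ?_⟩
  · rcases position_trichotomy hp with hind | ⟨t, h1, h2, h3, h4⟩ | ⟨L, hL, hs, hpos⟩
    · exact (isRelativelyStable_of_linearIndependent hp hm hind).2
    · exact (isRelativelyStable_iff_of_four_points hp hm t h1 h2 h3 h4).2
    · let e : (Fin 2 → ℂ) ≃ₗ[ℂ] L := LinearEquiv.ofFinrankEq _ _ (by rw [hL]; simp)
      rcases hpos with hpL | ⟨hs4, j₀, hj₀, hpL⟩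
      · obtain ⟨q, hq⟩ := exists_map_eq e hpL
        exact (isRelativelyStable_iff_of_collinear hp hm hL hs hpL e hq).2
      · obtain ⟨q, hq⟩ := exists_map_eq e (p := fun j : {j : Fin s // j ≠ j₀} => p j)
          fun j => hpL j j.2
        exact (isRelativelyStable_iff_of_collinear_compl hp hm hL hs4 hj₀ hpL e hq).2
  · have hind : LinearIndependent ℂ fun j => (p j).rep := by
      rcases h with hs | ⟨rfl, hnot⟩
      · exact linearIndependent_rep_of_le_two hp hs
      · have hrange : Set.range p = {p 0, p 1, p 2} := by
          ext x
          simp [Fin.exists_fin_succ, eq_comm]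
        have h := linearIndependent_rep_of_not_isCollinear (hrange ▸ hnot)
        have he : (fun j => (p j).rep) = ![(p 0).rep, (p 1).rep, (p 2).rep] := by
          ext1 i
          fin_cases i <;> rfl
        rwa [he]
    exact (isRelativelyStable_of_linearIndependent hp hm hind).1.mpr trivial
  · have hpL' : ∀ j, (p j).rep ∈ L := fun j => (hmem L _).mp (hpL j)
    exact iff_isChowStableOnLine hL hpL' fun e q hq =>
      (isRelativelyStable_iff_of_collinear hp hm hL hs hpL' e hq).1
  · have hpL' : ∀ j, j ≠ j₀ → (p j).rep ∈ L := fun j hj => (hmem L _).mp (hpL j hj)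
    exact iff_isChowStableOnLine hL (p := fun j : {j : Fin s // j ≠ j₀} => p j)
      (fun j => hpL' j j.2) fun e q hq =>
      (isRelativelyStable_iff_of_collinear_compl hp hm hL hs (mt (hmem L _).mpr hj₀) hpL' e hq).1
  · rintro ⟨a, ha⟩
    exact (isRelativelyStable_iff_of_four_points hp hm a
      (linearIndependent_rep_of_not_isCollinear (ha 0 1 2 (by decide) (by decide) (by decide)))
      (linearIndependent_rep_of_not_isCollinear (ha 0 1 3 (by decide) (by decide) (by decide)))
      (linearIndependent_rep_of_not_isCollinear (ha 0 2 3 (by decide) (by decide) (by decide)))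
      (linearIndependent_rep_of_not_isCollinear (ha 1 2 3 (by decide) (by decide) (by decide)))).1
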